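/- Let $K$ be a convex body in the Euclidean plane (a compact convex set with nonempty interior), and let $|\cdot|$ denote area. For $\theta\in\mathbb R$ put $u(\theta)=(\cos\theta,\sin\theta)$ and $u'(\theta)=(-\sin\theta,\cos\theta)$. For $\alpha\in\,]0,1[$, an $\alpha$-section of $K$ is an oriented line $\Delta$ such that the part of $K$ in the closed half-plane $\Delta^-$ on the right of $\Delta$ has area $\alpha|K|$. For each $\theta$ there is exactly one $\alpha$-section $\Delta(\alpha,\theta)$ of direction $u(\theta)$. Let $m(\alpha,\theta)$ be the midpoint of the chord $\Delta(\alpha,\theta)\cap K$, and let $m^*_\alpha=\{m(\alpha,\theta):\theta\in\mathbb R\}$. The $\alpha$-core $K_\alpha$ is the intersection of the closed left half-planes $\Delta^+$ of all $\alpha$-sections $\Delta$ of $K$. Let $v_l(\alpha,\theta)$ and $v_r(\alpha,\theta)$ be the scalar products with $u(\theta)$ of the left and right derivatives of $m(\alpha,\cdot)$ at $\theta$, and let $\alpha_B$ be the infimum of all $\alpha\in\,]0,1[$ for which there is a $\theta$ such that the segment with endpoints $v_l(\alpha,\theta)$ and $v_r(\alpha,\theta)$ contains a negative number. Then: 1.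 For every $\alpha\in\,]0,1[$, the curve $m(\alpha,\cdot)$ is the envelope of the $\alpha$-sections of $K$: for every $\theta$, the point $m(\alpha,\theta)$ lies on $\Delta(\alpha,\theta)$, and $m(\alpha,\cdot)$ has a left and a right derivative at $\theta$, both collinear to $u(\theta)$. 2. For every $\alpha\in\,]0,1[$, $m^*_\alpha=\partial K_\alpha$ if and only if $\alpha\le\alpha_B$. 3. There is a value $\alpha_K$ with $0<\alpha_K\le\frac12$ and $\alpha_K\ge\alpha_B$ such that $K_\alpha$ is strictly convex with nonempty interior if $0<\alpha<\alpha_K$, $K_{\alpha_K}$ is a single point, and $K_\alpha$ is empty if $\alpha_K<\alpha<1$. 4. $K$ is not centrally symmetric if and only if there is a (nondegenerate) triangle $T$ with $|T\cap K|>\frac12|K|$, one side of which is contained in $K$ and the two other sides of which are disjoint from the interior of $K$. -/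

import Mathlib

open Set MeasureTheory

noncomputable section

namespace AlphaSection

/-- The Euclidean plane. -/
abbrev Plane : Type := EuclideanSpace ℝ (Fin 2)

/-- The unit vector `u(θ) = (cos θ, sin θ)`. -/
def dir (θ : ℝ) : Plane := !₂[Real.cos θ, Real.sin θ]

/-- The unit vector `u'(θ) = (-sin θ, cos θ)`, pointing to the left of `u(θ)`. -/
def nrm (θ : ℝ) : Plane := !₂[-Real.sin θ, Real.cos θ]

/-- The line oriented by `u(θ)` at signed distance `t` from the origin. -/
def line (θ t : ℝ) : Set Plane := {x | inner ℝ x (nrm θ) = t}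

/-- The closed half-plane on the left of the oriented line `(θ, t)`. -/
def leftHalf (θ t : ℝ) : Set Plane := {x | t ≤ inner ℝ x (nrm θ)}

/-- The closed half-plane on the right of the oriented line `(θ, t)`. -/
def rightHalf (θ t : ℝ) : Set Plane := {x | inner ℝ x (nrm θ) ≤ t}

/-- The oriented line `(θ, t)` is an `α`-section of `K`: the part of `K` on its right has area
`α |K|`. -/
def IsSection (K : Set Plane) (α θ t : ℝ) : Prop :=
  volume.real (rightHalf θ t ∩ K) = α * volume.real K

/-- The `α`-core of `K`: the intersection of the left half-planes of all `α`-sections of `K`. -/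
def core (K : Set Plane) (α : ℝ) : Set Plane :=
  {x | ∀ θ t : ℝ, IsSection K α θ t → x ∈ leftHalf θ t}

/-- The signed distance from the origin of the `α`-section of `K` of direction `θ`. For a convex
body `K` and `0 < α < 1` there is exactly one such section, so the infimum is over a singleton. -/
def offset (K : Set Plane) (α θ : ℝ) : ℝ := sInf {t | IsSection K α θ t}

/-- The point of the `α`-section of direction `θ` with abscissa `s` along `u(θ)`. -/
def sectionPoint (K : Set Plane) (α θ s : ℝ) : Plane :=
  s • dir θ + offset K α θ • nrm θ

/-- The set of abscissae, along `u(θ)`, of the points of the chord that the `α`-section of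
direction `θ` cuts from `K`. -/
def chordAbscissae (K : Set Plane) (α θ : ℝ) : Set ℝ := {s | sectionPoint K α θ s ∈ K}

/-- The initial endpoint `b(α, θ)` of the chord. -/
def chordStart (K : Set Plane) (α θ : ℝ) : Plane :=
  sectionPoint K α θ (sInf (chordAbscissae K α θ))

/-- The final endpoint `c(α, θ)` of the chord. -/
def chordEnd (K : Set Plane) (α θ : ℝ) : Plane :=
  sectionPoint K α θ (sSup (chordAbscissae K α θ))

/-- The midpoint `m(α, θ)` of the chord. -/
def mid (K : Set Plane) (α θ : ℝ) : Plane :=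
  midpoint ℝ (chordStart K α θ) (chordEnd K α θ)

/-- The image `m*_α` of the curve `m(α, ·)`. -/
def midImage (K : Set Plane) (α : ℝ) : Set Plane := range (mid K α)

/-- The curve `γ` is the envelope of the family of oriented lines `(θ, t θ)`: each `γ θ` is on the
line of direction `θ`, and `γ` has a left and a right derivative at `θ`, both collinear to
`u(θ)`. -/
def IsEnvelope (t : ℝ → ℝ) (γ : ℝ → Plane) : Prop :=
  ∀ θ : ℝ, γ θ ∈ line θ (t θ) ∧
    (∃ v : ℝ, HasDerivWithinAt γ (v • dir θ) (Iio θ) θ) ∧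
    (∃ v : ℝ, HasDerivWithinAt γ (v • dir θ) (Ioi θ) θ)

/-- The left velocity `v_l = ⟨m'_l, u⟩`. -/
def velL (K : Set Plane) (α θ : ℝ) : ℝ := inner ℝ (derivWithin (mid K α) (Iio θ) θ) (dir θ)

/-- The right velocity `v_r = ⟨m'_r, u⟩`. -/
def velR (K : Set Plane) (α θ : ℝ) : ℝ := inner ℝ (derivWithin (mid K α) (Ioi θ) θ) (dir θ)

/-- The backwards set `B(α)`: the directions `θ` for which the segment `V` with endpoints `v_l` and
`v_r` contains a negative number (where `m` is differentiable, this says `v < 0`). -/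
def backwards (K : Set Plane) (α : ℝ) : Set ℝ :=
  {θ | (uIcc (velL K α θ) (velR K α θ) ∩ Iio 0).Nonempty}

/-- The critical value `α_B`: the infimum of all `α` in `]0, 1[` with `B(α) ≠ ∅`. -/
def alphaB (K : Set Plane) : ℝ := sInf {α | α ∈ Ioo (0 : ℝ) 1 ∧ (backwards K α).Nonempty}

/-- `K` is centrally symmetric about some point `p`. -/
def IsSymmetric (K : Set Plane) : Prop :=
  ∃ p : Plane, ∀ x ∈ K, AffineEquiv.pointReflection ℝ p x ∈ K

end AlphaSection

end

/-!
Everything is expressed in the orthonormal frame `(u(θ), u'(θ))`, with coordinates `pt θ s t`. Let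
`h = offset K α`, let `reach K θ t` be the abscissa of the last point of `K` on the line `(θ, t)`;
by the half-turn `θ ↦ θ + π`, the first point has abscissa `-reach K (θ + π) (-t)`.

*The envelope.* Rotating a line about one of its points of abscissa `x₀`, the area cut off from `K`
varies at the rate `∫ (x - x₀) dx` over the chord (`IsBody.hasDerivAt_area_rotate`). This rate
vanishes exactly at the midpoint of the chord, so `h' = -midAbs`, where `midAbs` is the abscissa of
the midpoint (`IsBody.hasDerivAt_offset`). It follows that, in the fixed frame of direction `θ`, the
ordinate of the end of the section of direction `φ` has at `φ = θ` the positive derivative `L / 2`,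
with `L` the length of the section, while its abscissa is the concave function `reach K θ` of this
ordinate, which has one-sided derivatives. The other end is symmetric, and the ordinates compensate:
the midpoint has one-sided derivatives, equal to `L / 4` times the difference of the one-sided
slopes of the two arcs of the boundary, along `u(θ)` (`IsBody.hasDerivWithinAt_mid`). By concavity
the sign of this difference can only go from nonnegative to negative when `α` increases
(`IsBody.backwards_subset`).

*The core.* The core is the superlevel set `α |K| ≤ depth K` of the least area cut off by a line
through a point, and its interior is the strict superlevel set. A point of the core on the section
of direction `θ` minimizes `⟨x, u'(φ)⟩ - h(φ)` at `φ = θ`; since the derivative vanishes there, the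
point is the midpoint of the section (`IsBody.eq_mid_of_mem_core`). Therefore the boundary of the
core consists of midpoints, the core is strictly convex, and `αK` is the maximal depth divided by
`|K|`. Moreover the curve of midpoints is the boundary of the core if and only if it lies in the
core. When the midpoint never moves backwards, this holds because the distance of the midpoint to a
given section increases during both half-turns away from it
(`IsBody.mid_mem_core_of_backwards_eq_empty`); the converse is a comparison of nearby midpoints.
At the value `alphaB K` itself one passes to the limit from below.

*Symmetry.* If no midpoint moves backwards for `α < 1/2`, the midpoints for `α = 1/2` all belong to
a core with at most one point, hence coincide, and `K` is symmetric. Otherwise the midpoint moves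
backwards for some `α < 1/2`, which says that supporting lines at the two ends of a section meet on
its left: with the section they bound a triangle containing the left part of `K`, of area
`(1 - α) |K|` (`IsBody.exists_triangle`). Conversely, such a triangle prevents symmetry by an
argument in barycentric coordinates (`IsBody.not_isSymmetric_of_triangle`).
-/

noncomputable section

namespace AlphaSection

open Filter Topology Real

variable {K : Set Plane}

/-! ### Rotating frames -/

/-- The point with coordinates `(s, t)` in the orthonormal frame `(u(θ), u'(θ))`. -/
def pt (θ s t : ℝ) : Plane := s • dir θ + t • nrm θ

lemma pt_apply_zero (θ s t : ℝ) : pt θ s t 0 = s * cos θ - t * sin θ := by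
  simp [pt, dir, nrm]; ring

lemma pt_apply_one (θ s t : ℝ) : pt θ s t 1 = s * sin θ + t * cos θ := by
  simp [pt, dir, nrm]

lemma inner_dir (x : Plane) (θ : ℝ) : inner ℝ x (dir θ) = x 0 * cos θ + x 1 * sin θ := by
  simp [dir, PiLp.inner_apply, Fin.sum_univ_two, mul_comm]

lemma inner_nrm (x : Plane) (θ : ℝ) : inner ℝ x (nrm θ) = x 1 * cos θ - x 0 * sin θ := by
  simp [nrm, PiLp.inner_apply, Fin.sum_univ_two]; ring

lemma inner_pt_nrm (θ φ s t : ℝ) :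
    inner ℝ (pt θ s t) (nrm φ) = s * sin (θ - φ) + t * cos (θ - φ) := by
  rw [inner_nrm, pt_apply_zero, pt_apply_one, sin_sub, cos_sub]; ring

lemma inner_pt_dir (θ φ s t : ℝ) :
    inner ℝ (pt θ s t) (dir φ) = s * cos (θ - φ) - t * sin (θ - φ) := by
  rw [inner_dir, pt_apply_zero, pt_apply_one, sin_sub, cos_sub]; ring

@[simp] lemma inner_pt_nrm_self (θ s t : ℝ) : inner ℝ (pt θ s t) (nrm θ) = t := by
  simp [inner_pt_nrm]

@[simp] lemma inner_pt_dir_self (θ s t : ℝ) : inner ℝ (pt θ s t) (dir θ) = s := by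
  simp [inner_pt_dir]

lemma pt_inner (θ : ℝ) (x : Plane) : pt θ (inner ℝ x (dir θ)) (inner ℝ x (nrm θ)) = x := by
  have h := sin_sq_add_cos_sq θ
  ext i
  fin_cases i
  · simp only [Fin.zero_eta, pt_apply_zero, inner_dir, inner_nrm]
    linear_combination (x 0) * h
  · simp only [Fin.mk_one, pt_apply_one, inner_dir, inner_nrm]
    linear_combination (x 1) * h

lemma pt_add_pi (θ s t : ℝ) : pt (θ + π) s t = pt θ (-s) (-t) := by
  ext i
  fin_cases i <;> simp [pt_apply_zero, pt_apply_one]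

lemma nrm_add_pi (θ : ℝ) : nrm (θ + π) = -nrm θ := by
  ext i
  fin_cases i <;> simp [nrm]

lemma nrm_periodic : Function.Periodic nrm (2 * π) := fun θ => by simp [nrm]

lemma dir_periodic : Function.Periodic dir (2 * π) := fun θ => by simp [dir]

lemma norm_nrm (θ : ℝ) : ‖nrm θ‖ = 1 := by
  simp [nrm, EuclideanSpace.norm_eq, Fin.sum_univ_two]

lemma norm_dir (θ : ℝ) : ‖dir θ‖ = 1 := by
  simp [dir, EuclideanSpace.norm_eq, Fin.sum_univ_two]

lemma inner_dir_nrm (θ φ : ℝ) : inner ℝ (dir φ) (nrm θ) = sin (φ - θ) := by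
  rw [inner_nrm, sin_sub]; simp [dir]

@[fun_prop]
lemma continuous_dir : Continuous dir := by
  unfold dir
  fun_prop

@[fun_prop]
lemma continuous_nrm : Continuous nrm := by
  unfold nrm
  fun_prop

@[fun_prop]
lemma continuous_pt {X : Type*} [TopologicalSpace X] {f g h : X → ℝ} (hf : Continuous f)
    (hg : Continuous g) (hh : Continuous h) : Continuous fun x => pt (f x) (g x) (h x) := by
  unfold pt
  fun_prop

/-- Every vector is a nonnegative multiple of some `u(θ)`. -/
lemma exists_smul_dir (x : Plane) : ∃ θ : ℝ, x = ‖x‖ • dir θ := by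
  refine ⟨Complex.arg ⟨x 0, x 1⟩, ?_⟩
  have hn : ‖(⟨x 0, x 1⟩ : ℂ)‖ = ‖x‖ := by
    rw [Complex.norm_def, EuclideanSpace.norm_eq, Complex.normSq_mk, Fin.sum_univ_two]
    simp [sq]
  have h1 := Complex.norm_mul_cos_arg ⟨x 0, x 1⟩
  have h2 := Complex.norm_mul_sin_arg ⟨x 0, x 1⟩
  rw [hn] at h1 h2
  ext i
  fin_cases i
  · simpa [dir] using h1.symm
  · simpa [dir] using h2.symm

lemma pt_combo (θ a b s₁ t₁ s₂ t₂ : ℝ) :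
    a • pt θ s₁ t₁ + b • pt θ s₂ t₂ = pt θ (a * s₁ + b * s₂) (a * t₁ + b * t₂) := by
  unfold pt; module

/-- The coordinates in a rotated orthonormal frame preserve area. -/
lemma measurePreserving_pt (θ : ℝ) :
    MeasurePreserving (fun p : ℝ × ℝ => pt θ p.1 p.2) := by
  have ho : Orthonormal ℝ ![dir θ, nrm θ] := by
    rw [orthonormal_iff_ite]
    intro i j
    fin_cases i <;> fin_cases j
    · simp [norm_dir]
    · simp [inner_dir_nrm]
    · simp [real_inner_comm, inner_dir_nrm]
    · simp [norm_nrm]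
  let B : OrthonormalBasis (Fin 2) ℝ Plane :=
    OrthonormalBasis.mk ho (by
      have := ho.linearIndependent.span_eq_top_of_card_eq_finrank (by simp)
      rw [this])
  have h1 := B.measurePreserving_repr_symm
  have h2 := (EuclideanSpace.volume_preserving_symm_measurableEquiv_toLp (Fin 2)).symm
  have h3 := (volume_preserving_finTwoArrow ℝ).symm
  have he : (fun p : ℝ × ℝ => pt θ p.1 p.2) =
      B.repr.symm ∘ (MeasurableEquiv.toLp 2 (Fin 2 → ℝ)).symm.symm ∘
        MeasurableEquiv.finTwoArrow.symm := by
    ext1 p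
    simp only [Function.comp_apply, B, ← OrthonormalBasis.sum_repr_symm, pt, Fin.sum_univ_two,
      OrthonormalBasis.coe_mk]
    simp
  rw [he]
  exact h1.comp (h2.comp h3)

/-! ### The area cut off by a line -/

/-- The area of the part of `K` on the right of the oriented line `(θ, t)`. -/
def area (K : Set Plane) (θ t : ℝ) : ℝ := volume.real (rightHalf θ t ∩ K)

lemma continuous_inner_nrm (θ : ℝ) : Continuous fun x : Plane => (inner ℝ x (nrm θ) : ℝ) := by
  fun_prop

lemma isClosed_rightHalf (θ t : ℝ) : IsClosed (rightHalf θ t) :=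
  isClosed_le (continuous_inner_nrm θ) continuous_const

lemma isClosed_leftHalf (θ t : ℝ) : IsClosed (leftHalf θ t) :=
  isClosed_le continuous_const (continuous_inner_nrm θ)

lemma isClosed_line (θ t : ℝ) : IsClosed (line θ t) :=
  isClosed_eq (continuous_inner_nrm θ) continuous_const

lemma volume_line (θ t : ℝ) : volume (line θ t) = 0 := by
  rw [← (measurePreserving_pt θ).measure_preimage
    (isClosed_line θ t).measurableSet.nullMeasurableSet]
  have : (fun p : ℝ × ℝ => pt θ p.1 p.2) ⁻¹' line θ t = univ ×ˢ {t} := by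
    ext p; simp [line]
  rw [this, Measure.volume_eq_prod, Measure.prod_prod]
  simp

lemma area_mono {K : Set Plane} (hK : IsCompact K) (θ : ℝ) : Monotone (area K θ) := by
  intro s t hst
  refine measureReal_mono ?_ (measure_ne_top_of_subset inter_subset_right hK.measure_ne_top)
  gcongr
  intro x hx
  exact le_trans (show inner ℝ x (nrm θ) ≤ s from hx) hst

/-- A line is a null set, so the area cut off varies continuously with the line. -/
lemma continuous_area {K : Set Plane} (hK : IsCompact K) :
    Continuous fun p : ℝ × ℝ => area K p.1 p.2 := by
  rw [continuous_iff_continuousAt]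
  rintro ⟨θ, t⟩
  refine (ENNReal.tendsto_toReal
    (measure_ne_top_of_subset inter_subset_right hK.measure_ne_top)).comp ?_
  refine tendsto_measure_of_ae_tendsto_indicator (𝓝 (θ, t))
    ((isClosed_rightHalf θ t).measurableSet.inter hK.measurableSet)
    (fun p => (isClosed_rightHalf p.1 p.2).measurableSet.inter hK.measurableSet)
    hK.measurableSet hK.measure_ne_top (Eventually.of_forall fun p => inter_subset_right) ?_
  have h0 : ∀ᵐ x : Plane, x ∉ line θ t := measure_eq_zero_iff_ae_notMem.1 (volume_line θ t)
  filter_upwards [h0] with x hx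
  have hc : Continuous fun p : ℝ × ℝ => (inner ℝ x (nrm p.1) : ℝ) := by fun_prop
  rcases lt_or_gt_of_ne (show inner ℝ x (nrm θ) ≠ t from hx) with h | h
  · filter_upwards [hc.continuousAt.eventually_lt continuous_snd.continuousAt h] with p hp
    have hp : inner ℝ x (nrm p.1) < p.2 := hp
    simp [rightHalf, h.le, hp.le]
  · filter_upwards [continuous_snd.continuousAt.eventually_lt hc.continuousAt h] with p hp
    have hp : p.2 < inner ℝ x (nrm p.1) := hp
    simp [rightHalf, h.not_ge, hp.not_ge]

lemma leftHalf_eq_rightHalf (θ t : ℝ) : leftHalf θ t = rightHalf (θ + π) (-t) := by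
  ext x; simp [rightHalf, leftHalf, nrm_add_pi]

lemma area_add_pi {K : Set Plane} (hK : IsCompact K) (θ t : ℝ) :
    area K (θ + π) (-t) = volume.real K - area K θ t := by
  have hu : K = (rightHalf θ t ∩ K) ∪ (leftHalf θ t ∩ K) := by
    rw [← union_inter_distrib_right, eq_comm, inter_eq_right]
    intro x _
    exact le_total (inner ℝ x (nrm θ) : ℝ) t
  have hd : AEDisjoint volume (rightHalf θ t ∩ K) (leftHalf θ t ∩ K) := by
    refine measure_mono_null ?_ (volume_line θ t)
    rintro x ⟨⟨h1, -⟩, ⟨h2, -⟩⟩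
    exact le_antisymm h1 h2
  have := measureReal_union₀ (μ := volume) (s := rightHalf θ t ∩ K) (t := leftHalf θ t ∩ K)
    ((isClosed_leftHalf θ t).measurableSet.inter hK.measurableSet).nullMeasurableSet hd
    (measure_ne_top_of_subset inter_subset_right hK.measure_ne_top)
    (measure_ne_top_of_subset inter_subset_right hK.measure_ne_top)
  rw [← hu] at this
  rw [area, area, ← leftHalf_eq_rightHalf]
  linarith

/-- A line through an interior point cuts off a positive area on its right. -/
lemma area_pos_of_mem {K : Set Plane} (hK : IsCompact K) {θ t : ℝ} {x : Plane}
    (hx : x ∈ interior K) (ht : inner ℝ x (nrm θ) ≤ t) : 0 < area K θ t := by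
  have ho : IsOpen (interior K ∩ {y : Plane | inner ℝ y (nrm θ) < t}) :=
    isOpen_interior.inter (isOpen_lt (continuous_inner_nrm θ) continuous_const)
  have hne : (interior K ∩ {y : Plane | inner ℝ y (nrm θ) < t}).Nonempty := by
    have hc : ContinuousAt (fun ε : ℝ => x - ε • nrm θ) 0 := by fun_prop
    have h1 : ∀ᶠ ε in 𝓝[>] (0 : ℝ), x - ε • nrm θ ∈ interior K :=
      (hc.mono_left nhdsWithin_le_nhds).eventually
        (isOpen_interior.mem_nhds (by simpa using hx))
    obtain ⟨ε, h1, h2⟩ := (h1.and self_mem_nhdsWithin).exists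
    refine ⟨_, h1, ?_⟩
    have h2 : 0 < ε := h2
    simp only [mem_ofPred_eq, inner_sub_left, inner_smul_left, real_inner_self_eq_norm_sq, norm_nrm]
    simp; linarith
  refine ENNReal.toReal_pos ?_ (measure_ne_top_of_subset inter_subset_right hK.measure_ne_top)
  refine ((ho.measure_pos volume hne).trans_le (measure_mono ?_)).ne'
  rintro y ⟨h1, h2⟩
  exact ⟨(show inner ℝ y (nrm θ) < t from h2).le, interior_subset h1⟩

/-- If both sides of the line `(θ, t)` contain a positive area of `K`, the line meets the interior
of `K`. -/
lemma exists_mem_interior_of_area {K : Set Plane} (hc : Convex ℝ K) (hK : IsCompact K)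
    {θ t : ℝ} (h0 : 0 < area K θ t) (h1 : area K θ t < volume.real K) :
    ∃ s, pt θ s t ∈ interior K := by
  -- a closed half-plane containing no interior point of `K` cuts off a null set
  have key : ∀ φ τ : ℝ, 0 < area K φ τ → ∃ x ∈ interior K, inner ℝ x (nrm φ) ≤ τ := by
    intro φ τ h
    by_contra! hcon
    have : rightHalf φ τ ∩ K ⊆ frontier K := by
      rintro x ⟨hx, hxK⟩
      exact ⟨subset_closure hxK, fun hx' => (hcon x hx').not_ge hx⟩
    have h2 : volume (rightHalf φ τ ∩ K) = 0 :=
      measure_mono_null this (hc.addHaar_frontier volume)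
    simp [area, Measure.real, h2] at h
  obtain ⟨x, hx, hxt⟩ := key θ t h0
  obtain ⟨y, hy, hyt⟩ := key (θ + π) (-t) (by rw [area_add_pi hK]; linarith)
  rw [nrm_add_pi, inner_neg_right, neg_le_neg_iff] at hyt
  obtain ⟨z, hz, hzt⟩ := hc.interior.isPreconnected.intermediate_value hx hy
    (continuous_inner_nrm θ).continuousOn ⟨hxt, hyt⟩
  exact ⟨inner ℝ z (dir θ), by rwa [← hzt, pt_inner]⟩

/-- The area cut off is strictly increasing in the offset where the line meets the interior. -/
lemma area_lt_area {K : Set Plane} (hK : IsCompact K) {θ t t' : ℝ}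
    (hs : ∃ s, pt θ s t ∈ interior K) (htt : t < t') : area K θ t < area K θ t' := by
  obtain ⟨s, hs⟩ := hs
  have ho : IsOpen (interior K ∩ {y : Plane | t < inner ℝ y (nrm θ) ∧ inner ℝ y (nrm θ) < t'}) :=
    isOpen_interior.inter ((isOpen_lt continuous_const (continuous_inner_nrm θ)).inter
      (isOpen_lt (continuous_inner_nrm θ) continuous_const))
  have hne : (interior K ∩
      {y : Plane | t < inner ℝ y (nrm θ) ∧ inner ℝ y (nrm θ) < t'}).Nonempty := by
    have hc : Continuous (fun τ : ℝ => pt θ s τ) := by fun_prop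
    have h1 : ∀ᶠ τ in 𝓝[>] t, pt θ s τ ∈ interior K :=
      (hc.continuousAt.mono_left nhdsWithin_le_nhds).eventually (isOpen_interior.mem_nhds hs)
    obtain ⟨τ, h1, h2⟩ := (h1.and (Ioo_mem_nhdsGT htt)).exists
    exact ⟨_, h1, by simpa using h2⟩
  have hpos := ho.measure_pos volume hne
  have hfin : ∀ τ, volume (rightHalf θ τ ∩ K) ≠ ⊤ := fun τ =>
    measure_ne_top_of_subset inter_subset_right hK.measure_ne_top
  refine (ENNReal.toReal_lt_toReal (hfin _) (hfin _)).2 ?_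
  have hd : Disjoint (rightHalf θ t ∩ K)
      (interior K ∩ {y : Plane | t < inner ℝ y (nrm θ) ∧ inner ℝ y (nrm θ) < t'}) := by
    rw [Set.disjoint_left]
    rintro x ⟨h1, -⟩ ⟨-, h2, -⟩
    exact h2.not_ge h1
  calc volume (rightHalf θ t ∩ K) < volume (rightHalf θ t ∩ K) + _ :=
        ENNReal.lt_add_right (hfin t) hpos.ne'
    _ = _ := (measure_union hd ho.measurableSet).symm
    _ ≤ _ := by
      refine measure_mono (union_subset ?_ ?_)
      · rintro x ⟨h1, h2⟩
        exact ⟨le_trans (show inner ℝ x (nrm θ) ≤ t from h1) htt.le, h2⟩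
      · rintro x ⟨h1, -, h2⟩
        exact ⟨h2.le, interior_subset h1⟩

/-! ### Sections -/

/-- A convex body of the plane: a compact convex set with nonempty interior. -/
structure IsBody (K : Set Plane) : Prop where
  convex : Convex ℝ K
  isCompact : IsCompact K
  nonempty : (interior K).Nonempty


lemma IsBody.volume_pos (hK : IsBody K) : 0 < volume.real K :=
  ENNReal.toReal_pos (Measure.measure_pos_of_nonempty_interior _ hK.nonempty).ne'
    hK.isCompact.measure_ne_top

/-- The line `(θ, t)` passes through the interior of `K`. -/
def Meets (K : Set Plane) (θ t : ℝ) : Prop := ∃ s, pt θ s t ∈ interior K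

lemma abs_inner_nrm_le (x : Plane) (θ : ℝ) : |(inner ℝ x (nrm θ) : ℝ)| ≤ ‖x‖ := by
  simpa [norm_nrm] using abs_real_inner_le_norm x (nrm θ)

lemma abs_inner_dir_le (x : Plane) (θ : ℝ) : |(inner ℝ x (dir θ) : ℝ)| ≤ ‖x‖ := by
  simpa [norm_dir] using abs_real_inner_le_norm x (dir θ)

/-- Beyond the radius of a disc around the origin that contains `K`, lines cut off nothing or
everything. -/
lemma area_eq_of_radius {R : ℝ} (hR : ∀ x ∈ K, ‖x‖ ≤ R) (θ : ℝ) {t : ℝ} :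
    (t < -R → area K θ t = 0) ∧ (R ≤ t → area K θ t = volume.real K) := by
  refine ⟨fun h => ?_, fun h => ?_⟩
  · have : rightHalf θ t ∩ K = ∅ := by
      rw [eq_empty_iff_forall_notMem]
      rintro x ⟨h1, h2⟩
      have h1 : inner ℝ x (nrm θ) ≤ t := h1
      linarith [abs_le.1 (abs_inner_nrm_le x θ), hR x h2]
    simp [area, this]
  · have : rightHalf θ t ∩ K = K := by
      rw [inter_eq_right]
      intro x h2
      show inner ℝ x (nrm θ) ≤ t
      linarith [abs_le.1 (abs_inner_nrm_le x θ), hR x h2]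
    rw [area, this]

lemma IsBody.exists_radius (hK : IsBody K) : ∃ R, ∀ x ∈ K, ‖x‖ ≤ R :=
  hK.isCompact.isBounded.exists_norm_le

lemma IsBody.exists_isSection (hK : IsBody K) {α : ℝ} (hα : α ∈ Ioo (0 : ℝ) 1) (θ : ℝ) :
    ∃ t, IsSection K α θ t := by
  obtain ⟨R, hR⟩ := hK.exists_radius
  have hV := hK.volume_pos
  have hcont : Continuous (area K θ) :=
    (continuous_area hK.isCompact).comp (f := fun t => (θ, t)) (by fun_prop)
  refine mem_range_of_exists_le_of_exists_ge hcont ⟨-R - 1, ?_⟩ ⟨R, ?_⟩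
  · change area K θ (-R - 1) ≤ _
    rw [(area_eq_of_radius hR θ).1 (by linarith)]
    have := hα.1
    positivity
  · change _ ≤ area K θ R
    rw [(area_eq_of_radius hR θ).2 le_rfl]
    nlinarith [hα.2]

lemma IsBody.meets_of_isSection (hK : IsBody K) {α : ℝ} (hα : α ∈ Ioo (0 : ℝ) 1)
    {θ t : ℝ} (h : IsSection K α θ t) : Meets K θ t := by
  have h : area K θ t = α * volume.real K := h
  have hV := hK.volume_pos
  refine exists_mem_interior_of_area hK.convex hK.isCompact ?_ ?_
  · rw [h]; exact mul_pos hα.1 hV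
  · rw [h]; nlinarith [hα.2]

lemma IsBody.isSection_iff (hK : IsBody K) {α : ℝ} (hα : α ∈ Ioo (0 : ℝ) 1) {θ t : ℝ} :
    IsSection K α θ t ↔ t = offset K α θ := by
  have huniq : ∀ t t', IsSection K α θ t → IsSection K α θ t' → t ≤ t' := by
    intro t t' h h'
    by_contra! hlt
    have := area_lt_area hK.isCompact (hK.meets_of_isSection hα h') hlt
    rw [show area K θ t = _ from h, show area K θ t' = _ from h'] at this
    exact this.false
  obtain ⟨t₀, h₀⟩ := hK.exists_isSection hα θ
  have hset : {t | IsSection K α θ t} = {t₀} := by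
    ext t
    refine ⟨fun h => le_antisymm (huniq _ _ h h₀) (huniq _ _ h₀ h), ?_⟩
    rintro rfl
    exact h₀
  have h1 : offset K α θ = t₀ := by rw [offset, hset, csInf_singleton]
  rw [h1]
  exact Set.ext_iff.1 hset t

lemma IsBody.area_offset (hK : IsBody K) {α : ℝ} (hα : α ∈ Ioo (0 : ℝ) 1) (θ : ℝ) :
    area K θ (offset K α θ) = α * volume.real K :=
  (hK.isSection_iff hα).2 rfl

lemma IsBody.meets_offset (hK : IsBody K) {α : ℝ} (hα : α ∈ Ioo (0 : ℝ) 1) (θ : ℝ) :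
    Meets K θ (offset K α θ) :=
  hK.meets_of_isSection hα (hK.area_offset hα θ)

lemma IsBody.offset_lt_iff (hK : IsBody K) {α : ℝ} (hα : α ∈ Ioo (0 : ℝ) 1) {θ t : ℝ} :
    offset K α θ < t ↔ α * volume.real K < area K θ t := by
  refine ⟨fun h => ?_, fun h => ?_⟩
  · rw [← hK.area_offset hα θ]
    exact area_lt_area hK.isCompact (hK.meets_offset hα θ) h
  · by_contra! hle
    exact h.not_ge ((area_mono hK.isCompact θ hle).trans_eq (hK.area_offset hα θ))

lemma IsBody.offset_le_iff (hK : IsBody K) {α : ℝ} (hα : α ∈ Ioo (0 : ℝ) 1) {θ t : ℝ} :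
    offset K α θ ≤ t ↔ α * volume.real K ≤ area K θ t := by
  refine ⟨fun h => ?_, fun h => ?_⟩
  · exact (hK.area_offset hα θ).symm.trans_le (area_mono hK.isCompact θ h)
  · rcases h.lt_or_eq with h | h
    · exact ((hK.offset_lt_iff hα).2 h).le
    · exact ((hK.isSection_iff hα).1 h.symm).ge

lemma IsBody.offset_lt_offset (hK : IsBody K) {α β : ℝ} (hα : α ∈ Ioo (0 : ℝ) 1)
    (hβ : β ∈ Ioo (0 : ℝ) 1) (h : α < β) (θ : ℝ) : offset K α θ < offset K β θ := by
  rw [hK.offset_lt_iff hα, hK.area_offset hβ]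
  exact mul_lt_mul_of_pos_right h hK.volume_pos

lemma IsBody.continuousAt_offset_param (hK : IsBody K) {α : ℝ} (hα : α ∈ Ioo (0 : ℝ) 1) (θ : ℝ) :
    ContinuousAt (fun β => offset K β θ) α := by
  have hn : ∀ᶠ β in 𝓝 α, β ∈ Ioo (0 : ℝ) 1 := isOpen_Ioo.mem_nhds hα
  have hm : ContinuousAt (fun β : ℝ => β * volume.real K) α := by fun_prop
  rw [ContinuousAt, tendsto_order]
  refine ⟨fun t ht => ?_, fun t ht => ?_⟩
  · rw [← not_le, hK.offset_le_iff hα, not_le] at ht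
    filter_upwards [continuousAt_const.eventually_lt hm ht, hn] with β hβ hβ'
    rwa [← not_le, hK.offset_le_iff hβ', not_le]
  · rw [gt_iff_lt, hK.offset_lt_iff hα] at ht
    filter_upwards [hm.eventually_lt continuousAt_const ht, hn] with β hβ hβ'
    rwa [hK.offset_lt_iff hβ']

lemma offset_periodic (K : Set Plane) (α : ℝ) : Function.Periodic (offset K α) (2 * π) := by
  intro θ
  simp [offset, IsSection, rightHalf, nrm_periodic θ]

/-! ### The end of a chord -/

/-- The abscissa along `u(θ)` of the last point of `K` on the oriented line `(θ, t)`. The abscissa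
of the first point is `-reach K (θ + π) (-t)`. The value is `0` on the lines that miss `K`. -/
def reach (K : Set Plane) (θ t : ℝ) : ℝ := sSup {s | pt θ s t ∈ K}

lemma IsBody.isCompact_fiber (hK : IsBody K) (θ t : ℝ) : IsCompact {s | pt θ s t ∈ K} := by
  obtain ⟨R, hR⟩ := hK.exists_radius
  refine Metric.isCompact_of_isClosed_isBounded ?_ ?_
  · exact hK.isCompact.isClosed.preimage (by fun_prop : Continuous fun s => pt θ s t)
  · refine isBounded_iff_forall_norm_le.2 ⟨R, fun s hs => ?_⟩
    have := abs_inner_dir_le (pt θ s t) θ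
    rw [inner_pt_dir_self] at this
    exact this.trans (hR _ hs)

lemma IsBody.le_reach (hK : IsBody K) {θ s t : ℝ} (h : pt θ s t ∈ K) : s ≤ reach K θ t :=
  le_csSup (hK.isCompact_fiber θ t).bddAbove h

lemma IsBody.reach_mem (hK : IsBody K) {θ s t : ℝ} (h : pt θ s t ∈ K) :
    pt θ (reach K θ t) t ∈ K :=
  (hK.isCompact_fiber θ t).sSup_mem ⟨s, h⟩

lemma sInf_fiber (K : Set Plane) (θ t : ℝ) :
    sInf {s | pt θ s t ∈ K} = -reach K (θ + π) (-t) := by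
  rw [Real.sInf_def, reach]
  congr 2
  ext s
  simp [pt_add_pi]

lemma IsBody.lt_reach (hK : IsBody K) {θ s t : ℝ} (h : pt θ s t ∈ interior K) :
    s < reach K θ t := by
  have hc : Continuous (fun r : ℝ => pt θ r t) := by fun_prop
  have h1 : ∀ᶠ r in 𝓝[>] s, pt θ r t ∈ interior K :=
    (hc.continuousAt.mono_left nhdsWithin_le_nhds).eventually (isOpen_interior.mem_nhds h)
  obtain ⟨r, h1, h2⟩ := (h1.and self_mem_nhdsWithin).exists
  exact lt_of_lt_of_le h2 (hK.le_reach (interior_subset h1))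

lemma IsBody.mem_interior_of_mem_Ico (hK : IsBody K) {θ s r r' t : ℝ}
    (h : pt θ s t ∈ interior K) (hr' : pt θ r' t ∈ K) (h1 : s ≤ r) (h2 : r < r') :
    pt θ r t ∈ interior K := by
  have hpos : 0 < r' - s := by linarith
  have := hK.convex.combo_interior_self_mem_interior h hr' (a := (r' - r) / (r' - s))
    (b := (r - s) / (r' - s)) (div_pos (by linarith) hpos) (div_nonneg (by linarith) hpos.le)
    (by field_simp; ring)
  rw [pt_combo] at this
  convert this using 2 <;> field_simp <;> ring

lemma Meets.add_pi {θ t : ℝ} (h : Meets K θ t) : Meets K (θ + π) (-t) := by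
  obtain ⟨s, hs⟩ := h
  exact ⟨-s, by simpa [pt_add_pi] using hs⟩

lemma reach_add_two_pi (K : Set Plane) (θ t : ℝ) : reach K (θ + π + π) t = reach K θ t := by
  simp [reach, pt_add_pi]

lemma IsBody.reach_mem_of_meets (hK : IsBody K) {θ t : ℝ} (h : Meets K θ t) :
    pt θ (reach K θ t) t ∈ K :=
  h.elim fun _ hs => hK.reach_mem (interior_subset hs)

lemma IsBody.neg_reach_lt_reach (hK : IsBody K) {θ t : ℝ} (h : Meets K θ t) :
    -reach K (θ + π) (-t) < reach K θ t := by
  obtain ⟨s, hs⟩ := h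
  have h1 := hK.lt_reach hs
  have h2 := hK.lt_reach (K := K) (θ := θ + π) (s := -s) (t := -t) (by simpa [pt_add_pi] using hs)
  linarith

lemma IsBody.mem_iff (hK : IsBody K) {θ s t : ℝ} (h : Meets K θ t) :
    pt θ s t ∈ K ↔ -reach K (θ + π) (-t) ≤ s ∧ s ≤ reach K θ t := by
  refine ⟨fun hs => ⟨?_, hK.le_reach hs⟩, fun ⟨h1, h2⟩ => ?_⟩
  · have := hK.le_reach (θ := θ + π) (s := -s) (t := -t) (by simpa [pt_add_pi] using hs)
    linarith
  · have e1 := hK.reach_mem_of_meets h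
    have e2 := hK.reach_mem_of_meets h.add_pi
    rw [pt_add_pi, neg_neg] at e2
    have hlt := sub_pos.2 (hK.neg_reach_lt_reach h)
    set a := -reach K (θ + π) (-t)
    set b := reach K θ t
    have := hK.convex e2 e1 (a := (b - s) / (b - a)) (b := (s - a) / (b - a))
      (div_nonneg (by linarith) hlt.le) (div_nonneg (by linarith) hlt.le)
      (by field_simp; ring)
    rw [pt_combo] at this
    convert this using 2 <;> field_simp <;> ring

lemma IsBody.mem_interior (hK : IsBody K) {θ s t : ℝ} (h : Meets K θ t)
    (h1 : -reach K (θ + π) (-t) < s) (h2 : s < reach K θ t) : pt θ s t ∈ interior K := by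
  obtain ⟨r, hr⟩ := id h
  rcases le_total r s with hrs | hrs
  · exact hK.mem_interior_of_mem_Ico hr (hK.reach_mem_of_meets h) hrs h2
  · have := hK.mem_interior_of_mem_Ico (θ := θ + π) (s := -r) (r := -s) (t := -t)
      (by simpa [pt_add_pi] using hr) (hK.reach_mem_of_meets h.add_pi) (by linarith)
      (by linarith)
    simpa [pt_add_pi] using this

lemma eventually_pt_mem {U : Set Plane} (hU : IsOpen U) {θ s t : ℝ} (h : pt θ s t ∈ U) :
    ∀ᶠ p : ℝ × ℝ in 𝓝 (θ, t), pt p.1 s p.2 ∈ U :=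
  (hU.preimage (by fun_prop : Continuous fun p : ℝ × ℝ => pt p.1 s p.2)).mem_nhds h

lemma IsBody.continuousAt_reach (hK : IsBody K) {θ t : ℝ} (h : Meets K θ t) :
    ContinuousAt (fun p : ℝ × ℝ => reach K p.1 p.2) (θ, t) := by
  have hev : ∀ r, pt θ r t ∈ interior K → ∀ᶠ p in 𝓝 (θ, t), pt p.1 r p.2 ∈ K := fun r hr =>
    (eventually_pt_mem isOpen_interior hr).mono fun p hp => interior_subset hp
  obtain ⟨s, hs⟩ := id h
  have hlt := hK.lt_reach hs
  rw [ContinuousAt, tendsto_order]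
  refine ⟨fun a ha => ?_, fun a ha => ?_⟩
  · obtain ⟨r, hr1, hr2⟩ := exists_between (max_lt ha hlt)
    have hri := hK.mem_interior_of_mem_Ico hs (hK.reach_mem_of_meets h)
      ((le_max_right a s).trans hr1.le) hr2
    filter_upwards [hev r hri] with p hp
    exact ((le_max_left a s).trans_lt hr1).trans_le (hK.le_reach hp)
  · have hna : pt θ a t ∉ K := fun hmem => (hK.le_reach hmem).not_gt ha
    filter_upwards [hev s hs, eventually_pt_mem hK.isCompact.isClosed.isOpen_compl hna]
      with p hp hp'
    by_contra! hle
    apply hp'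
    -- `a` lies between the abscissae `s` and `reach K p.1 p.2` of two points of `K`
    have e1 := hK.reach_mem hp
    set b := reach K p.1 p.2
    have hpos : 0 < b - s := by linarith
    have := hK.convex hp e1 (a := (b - a) / (b - s)) (b := (a - s) / (b - s))
      (div_nonneg (by linarith) hpos.le) (div_nonneg (by linarith) hpos.le)
      (by field_simp; ring)
    rw [pt_combo] at this
    convert this using 2 <;> field_simp <;> ring

/-- The offsets of the lines of direction `θ` that meet `K`. -/
def shadow (K : Set Plane) (θ : ℝ) : Set ℝ := {t | ∃ s, pt θ s t ∈ K}

lemma IsBody.concaveOn_reach (hK : IsBody K) (θ : ℝ) : ConcaveOn ℝ (shadow K θ) (reach K θ) := by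
  have key : ∀ ⦃t₁⦄, t₁ ∈ shadow K θ → ∀ ⦃t₂⦄, t₂ ∈ shadow K θ → ∀ ⦃a b : ℝ⦄, 0 ≤ a → 0 ≤ b →
      a + b = 1 → pt θ (a * reach K θ t₁ + b * reach K θ t₂) (a * t₁ + b * t₂) ∈ K := by
    rintro t₁ ⟨s₁, h₁⟩ t₂ ⟨s₂, h₂⟩ a b ha hb hab
    rw [← pt_combo]
    exact hK.convex (hK.reach_mem h₁) (hK.reach_mem h₂) ha hb hab
  exact ⟨fun t₁ h₁ t₂ h₂ a b ha hb hab => ⟨_, key h₁ h₂ ha hb hab⟩,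
    fun t₁ h₁ t₂ h₂ a b ha hb hab => hK.le_reach (key h₁ h₂ ha hb hab)⟩

lemma Meets.eventually {θ t : ℝ} (h : Meets K θ t) : ∀ᶠ p : ℝ × ℝ in 𝓝 (θ, t), Meets K p.1 p.2 := by
  obtain ⟨s, hs⟩ := h
  exact (eventually_pt_mem isOpen_interior hs).mono fun p hp => ⟨s, hp⟩

lemma Meets.mem_interior_shadow {θ t : ℝ} (h : Meets K θ t) : t ∈ interior (shadow K θ) := by
  rw [mem_interior_iff_mem_nhds]
  have hc : ContinuousAt (fun τ : ℝ => (θ, τ)) t := by fun_prop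
  filter_upwards [hc.eventually h.eventually] with τ ⟨s, hs⟩
  exact ⟨s, interior_subset hs⟩

/-! ### The derivative of the offset -/

lemma setIntegral_Iic_indicator_one {F : Set ℝ} (hF : MeasurableSet F) (τ : ℝ) :
    ∫ y in Iic τ, F.indicator (fun _ => (1 : ℝ)) y = volume.real (Iic τ ∩ F) := by
  rw [setIntegral_indicator hF]
  simp

/-- The length of a compact set of reals up to `τ`, as a primitive of its indicator function. -/
lemma volume_Iic_inter_sub {F : Set ℝ} (hF : IsCompact F) (τ₀ τ : ℝ) :
    volume.real (Iic τ ∩ F) - volume.real (Iic τ₀ ∩ F) =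
      ∫ y in τ₀..τ, F.indicator (fun _ => (1 : ℝ)) y := by
  have hint : Integrable (F.indicator (fun _ => (1 : ℝ))) :=
    (integrable_indicator_iff hF.measurableSet).2 (integrableOn_const hF.measure_ne_top)
  rw [← setIntegral_Iic_indicator_one hF.measurableSet,
    ← setIntegral_Iic_indicator_one hF.measurableSet,
    intervalIntegral.integral_Iic_sub_Iic hint.integrableOn hint.integrableOn]

lemma abs_volume_Iic_inter_sub_le {F : Set ℝ} (hF : IsCompact F) (τ₀ τ : ℝ) :
    |volume.real (Iic τ ∩ F) - volume.real (Iic τ₀ ∩ F)| ≤ |τ - τ₀| := by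
  rw [volume_Iic_inter_sub hF]
  have := intervalIntegral.norm_integral_le_of_norm_le_const (a := τ₀) (b := τ) (C := 1)
    (f := F.indicator (fun _ => (1 : ℝ))) (fun y _ => by
      by_cases hy : y ∈ F <;> simp [hy])
  simpa using this

lemma hasDerivAt_volume_Iic_inter {F : Set ℝ} (hF : IsCompact F) {τ₀ c : ℝ}
    (h : ∀ᶠ y in 𝓝 τ₀, F.indicator (fun _ => (1 : ℝ)) y = c) :
    HasDerivAt (fun τ => volume.real (Iic τ ∩ F)) c τ₀ := by
  have hint : Integrable (F.indicator (fun _ => (1 : ℝ))) :=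
    (integrable_indicator_iff hF.measurableSet).2 (integrableOn_const hF.measure_ne_top)
  have hca : ContinuousAt (F.indicator (fun _ => (1 : ℝ))) τ₀ :=
    (continuousAt_const (y := c)).congr (h.mono fun y hy => hy.symm)
  have h1 := intervalIntegral.integral_hasDerivAt_right (a := τ₀) (b := τ₀)
    hint.intervalIntegrable
    (hint.aestronglyMeasurable.stronglyMeasurableAtFilter) hca
  rw [h.self_of_nhds] at h1
  refine (h1.const_add (volume.real (Iic τ₀ ∩ F))).congr_of_eventuallyEq
    (Eventually.of_forall fun τ => ?_)
  simp only [← volume_Iic_inter_sub hF]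
  ring

/-- The ordinates, in the frame `(u(θ), u'(θ))`, of the points of `K` of abscissa `x`. -/
def column (K : Set Plane) (θ x : ℝ) : Set ℝ := {y | pt θ x y ∈ K}

lemma IsBody.isCompact_column (hK : IsBody K) (θ x : ℝ) : IsCompact (column K θ x) := by
  obtain ⟨R, hR⟩ := hK.exists_radius
  refine Metric.isCompact_of_isClosed_isBounded ?_ ?_
  · exact hK.isCompact.isClosed.preimage (by fun_prop : Continuous fun y => pt θ x y)
  · refine isBounded_iff_forall_norm_le.2 ⟨R, fun y hy => ?_⟩
    have := abs_inner_nrm_le (pt θ x y) θ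
    rw [inner_pt_nrm_self] at this
    exact this.trans (hR _ hy)

/-- The area on the right of the line of slope `k` through `(xq, h)`, in the frame of direction
`θ`, sliced by columns. -/
lemma IsBody.volume_below (hK : IsBody K) (θ xq h k : ℝ) :
    Integrable (fun x => volume.real (Iic (h + k * (x - xq)) ∩ column K θ x)) ∧
    volume.real {z ∈ K | inner ℝ z (nrm θ) ≤ h + k * (inner ℝ z (dir θ) - xq)} =
      ∫ x, volume.real (Iic (h + k * (x - xq)) ∩ column K θ x) := by
  have hcl : IsClosed {z ∈ K | inner ℝ z (nrm θ) ≤ h + k * (inner ℝ z (dir θ) - xq)} :=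
    hK.isCompact.isClosed.inter (isClosed_le (continuous_inner_nrm θ)
      (by fun_prop : Continuous fun z : Plane => h + k * (inner ℝ z (dir θ) - xq)))
  have hfin : volume {z ∈ K | inner ℝ z (nrm θ) ≤ h + k * (inner ℝ z (dir θ) - xq)} ≠ ⊤ :=
    measure_ne_top_of_subset inter_subset_left hK.isCompact.measure_ne_top
  have hmp := (measurePreserving_pt θ).measure_preimage hcl.measurableSet.nullMeasurableSet
  set S := (fun p : ℝ × ℝ => pt θ p.1 p.2) ⁻¹'
    {z ∈ K | inner ℝ z (nrm θ) ≤ h + k * (inner ℝ z (dir θ) - xq)} with hS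
  have hSm : MeasurableSet S := (measurePreserving_pt θ).measurable hcl.measurableSet
  have hsec : ∀ x, Prod.mk x ⁻¹' S = Iic (h + k * (x - xq)) ∩ column K θ x := by
    intro x
    ext y
    simp [hS, column, and_comm]
  rw [Measure.volume_eq_prod] at hmp
  have hSfin : (volume.prod volume : Measure (ℝ × ℝ)) S ≠ ⊤ := by rwa [hmp]
  have hint := Measure.integrable_measure_prodMk_left hSm hSfin
  simp only [hsec] at hint
  refine ⟨hint, ?_⟩
  rw [Measure.real, ← hmp, Measure.prod_apply hSm, integral_eq_lintegral_of_nonneg_ae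
    (Eventually.of_forall fun x => measureReal_nonneg) hint.aestronglyMeasurable]
  congr 1
  refine lintegral_congr fun x => ?_
  rw [hsec, ofReal_measureReal (measure_ne_top_of_subset inter_subset_right
    (hK.isCompact_column θ x).measure_ne_top)]

/-- Rotating a line about its point of abscissa `xq`, the area cut off varies at the rate
`∫ (x - xq) dx` over the chord. -/
lemma IsBody.hasDerivAt_volume_below (hK : IsBody K) {θ h : ℝ} (hm : Meets K θ h) (xq : ℝ) :
    HasDerivAt (fun k => ∫ x, volume.real (Iic (h + k * (x - xq)) ∩ column K θ x))
      (∫ x in Ioo (-reach K (θ + π) (-h)) (reach K θ h), (x - xq)) 0 := by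
  obtain ⟨R, hR⟩ := hK.exists_radius
  set a := -reach K (θ + π) (-h) with ha
  set b := reach K θ h with hb
  have hcol : ∀ x, x ∉ Icc (-R) R → column K θ x = ∅ := by
    intro x hx
    rw [eq_empty_iff_forall_notMem]
    intro y hy
    have := abs_inner_dir_le (pt θ x y) θ
    rw [inner_pt_dir_self] at this
    exact hx (abs_le.1 (this.trans (hR _ hy)))
  rw [← integral_indicator measurableSet_Ioo]
  refine (hasDerivAt_integral_of_dominated_loc_of_lip (s := univ)
    (bound := (Icc (-R) R).indicator fun _ => R + |xq|) univ_mem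
    (Eventually.of_forall fun k => (hK.volume_below θ xq h k).1.aestronglyMeasurable)
    (hK.volume_below θ xq h 0).1 ?_ (Eventually.of_forall fun x => ?_) ?_ ?_).2
  · exact ((by fun_prop : Measurable fun x : ℝ => x - xq).indicator
      measurableSet_Ioo).aestronglyMeasurable
  · refine LipschitzWith.lipschitzOnWith (LipschitzWith.of_dist_le_mul fun k k' => ?_)
    by_cases hx : x ∈ Icc (-R) R
    · rw [Real.dist_eq, Real.dist_eq]
      refine (abs_volume_Iic_inter_sub_le (hK.isCompact_column θ x) _ _).trans ?_
      have hb : |x - xq| ≤ R + |xq| := (abs_sub x xq).trans (by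
        gcongr; exact abs_le.2 hx)
      have : h + k * (x - xq) - (h + k' * (x - xq)) = (x - xq) * (k - k') := by ring
      rw [this, abs_mul]
      gcongr
      simp only [indicator_of_mem hx, Real.coe_nnabs]
      exact hb.trans (le_abs_self _)
    · simp [hcol x hx]
      positivity
  · exact (integrable_indicator_iff measurableSet_Icc).2
      (integrableOn_const measure_Icc_lt_top.ne)
  · have hne : ∀ c : ℝ, ∀ᵐ x : ℝ, x ≠ c := fun c => by
      simp [ae_iff]
    filter_upwards [hne a, hne b] with x hxa hxb
    have hout : ∀ x, pt θ x h ∉ K → ∀ᶠ y in 𝓝 h,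
        (column K θ x).indicator (fun _ => (1 : ℝ)) y = 0 := by
      intro x hx
      have : ∀ᶠ y in 𝓝 h, pt θ x y ∈ Kᶜ :=
        (hK.isCompact.isClosed.isOpen_compl.preimage
          (by fun_prop : Continuous fun y => pt θ x y)).mem_nhds hx
      filter_upwards [this] with y hy
      have hy' : y ∉ column K θ x := hy
      exact indicator_of_notMem hy' _
    have key : ∀ᶠ y in 𝓝 h, (column K θ x).indicator (fun _ => (1 : ℝ)) y =
        (Ioo a b).indicator (fun _ => (1 : ℝ)) x := by
      by_cases hx : x ∈ Ioo a b
      · rw [indicator_of_mem hx]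
        have : ∀ᶠ y in 𝓝 h, pt θ x y ∈ interior K :=
          (isOpen_interior.preimage
            (by fun_prop : Continuous fun y => pt θ x y)).mem_nhds (hK.mem_interior hm hx.1 hx.2)
        filter_upwards [this] with y hy
        have hy' : pt θ x y ∈ K := interior_subset hy
        exact indicator_of_mem (s := column K θ x) hy' _
      · rw [indicator_of_notMem hx]
        refine hout x fun hmem => hx ?_
        rw [hK.mem_iff hm] at hmem
        exact ⟨lt_of_le_of_ne hmem.1 (Ne.symm hxa), lt_of_le_of_ne hmem.2 hxb⟩
    have h1 := hasDerivAt_volume_Iic_inter (hK.isCompact_column θ x) key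
    have h2 : HasDerivAt (fun k : ℝ => h + k * (x - xq)) (x - xq) 0 := by
      simpa using ((hasDerivAt_id (0 : ℝ)).mul_const (x - xq)).const_add h
    have h3 := HasDerivAt.comp (h₂ := fun τ => volume.real (Iic τ ∩ column K θ x)) (0 : ℝ)
      (by simpa using h1) h2
    refine h3.congr_deriv ?_
    by_cases hx : x ∈ Ioo a b
    · rw [indicator_of_mem hx, indicator_of_mem hx]; ring
    · rw [indicator_of_notMem hx, indicator_of_notMem hx]; ring

lemma IsBody.hasDerivAt_area_rotate (hK : IsBody K) {θ h : ℝ} (hm : Meets K θ h) (xq : ℝ) :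
    HasDerivAt (fun φ => area K φ (inner ℝ (pt θ xq h) (nrm φ)))
      ((reach K θ h + reach K (θ + π) (-h)) *
        ((reach K θ h - reach K (θ + π) (-h)) / 2 - xq)) θ := by
  have h1 := hK.hasDerivAt_volume_below hm xq
  have h2 : HasDerivAt (fun φ => tan (φ - θ)) 1 θ := by
    have := HasDerivAt.comp (h := fun φ => φ - θ) (h₂ := tan) θ
      (Real.hasDerivAt_tan (x := θ - θ) (by simp)) ((hasDerivAt_id θ).sub_const θ)
    exact this.congr_deriv (by simp)
  have h3 := HasDerivAt.comp (h₂ := fun k => ∫ x, volume.real (Iic (h + k * (x - xq)) ∩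
    column K θ x)) θ (by simpa using h1) h2
  have hval : (∫ x in Ioo (-reach K (θ + π) (-h)) (reach K θ h), (x - xq)) * 1 =
      (reach K θ h + reach K (θ + π) (-h)) *
        ((reach K θ h - reach K (θ + π) (-h)) / 2 - xq) := by
    rw [← integral_Ioc_eq_integral_Ioo,
      ← intervalIntegral.integral_of_le (hK.neg_reach_lt_reach hm).le,
      intervalIntegral.integral_sub (by simp) (by simp)]
    simp
    ring
  rw [hval] at h3
  refine h3.congr_of_eventuallyEq ?_
  have hcos : ∀ᶠ φ in 𝓝 θ, 0 < cos (φ - θ) :=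
    (continuousAt_const.eventually_lt (by fun_prop : ContinuousAt (fun φ => cos (φ - θ)) θ)
      (by simp))
  filter_upwards [hcos] with φ hφ
  simp only [Function.comp_apply]
  rw [← (hK.volume_below θ xq h _).2, area]
  congr 1
  ext z
  simp only [rightHalf, mem_inter_iff, mem_ofPred_eq, and_comm (b := z ∈ K)]
  refine and_congr_right fun _ => ?_
  set x := (inner ℝ z (dir θ) : ℝ) with hx
  set y := (inner ℝ z (nrm θ) : ℝ) with hy
  rw [← pt_inner θ z, inner_pt_nrm, inner_pt_nrm, ← hx, ← hy, Real.tan_eq_sin_div_cos,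
    ← neg_sub φ θ, sin_neg, cos_neg, div_mul_eq_mul_div, ← sub_le_iff_le_add' (a := y),
    le_div_iff₀ hφ]
  constructor <;> intro h <;> linarith

/-- The abscissa of the midpoint of the `α`-section of direction `θ`. -/
def midAbs (K : Set Plane) (α θ : ℝ) : ℝ :=
  (reach K θ (offset K α θ) - reach K (θ + π) (-offset K α θ)) / 2

/-- The abscissa of the midpoint is minus the derivative of the offset: rotating about a point of
the section beyond the midpoint decreases the area to first order, so the section of the same
area passes on the left of that point, and symmetrically before the midpoint. -/
lemma IsBody.hasDerivAt_offset (hK : IsBody K) {α : ℝ} (hα : α ∈ Ioo (0 : ℝ) 1) (θ : ℝ) :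
    HasDerivAt (offset K α) (-midAbs K α θ) θ := by
  set h := offset K α θ with hh
  set m := midAbs K α θ with hmdef
  have hm := hK.meets_offset hα θ
  have hL : 0 < reach K θ h + reach K (θ + π) (-h) := by linarith [hK.neg_reach_lt_reach hm]
  have hline : ∀ xq, HasDerivAt (fun φ => (inner ℝ (pt θ xq h) (nrm φ) : ℝ)) (-xq) θ := by
    intro xq
    simp only [inner_pt_nrm]
    have e1 : HasDerivAt (fun φ : ℝ => θ - φ) (-1) θ := by
      simpa using (hasDerivAt_id θ).const_sub θ
    exact ((e1.sin.const_mul xq).add (e1.cos.const_mul h)).congr_deriv (by simp)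
  have harea : ∀ xq, HasDerivAt (fun φ => area K φ (inner ℝ (pt θ xq h) (nrm φ)))
      ((reach K θ h + reach K (θ + π) (-h)) * (m - xq)) θ := fun xq =>
    hK.hasDerivAt_area_rotate hm xq
  have hself : ∀ xq, area K θ (inner ℝ (pt θ xq h) (nrm θ)) = α * volume.real K := fun xq => by
    rw [inner_pt_nrm_self, hK.area_offset hα]
  rw [hasDerivAt_iff_tendsto_slope, tendsto_order]
  refine ⟨fun c hc => ?_, fun c hc => ?_⟩
  · have h1 := (hasDerivAt_iff_tendsto_slope.1 (harea ((m - c) / 2))).eventually_lt_const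
      (show _ < (0 : ℝ) from mul_neg_of_pos_of_neg hL (by linarith))
    have h2 := (hasDerivAt_iff_tendsto_slope.1 (hline ((m - c) / 2))).eventually_const_lt
      (show c < _ by linarith)
    filter_upwards [h1, h2, self_mem_nhdsWithin] with φ h1 h2 hne
    refine h2.trans ?_
    rw [slope_def_field, hself] at h1
    rw [slope_def_field, slope_def_field, inner_pt_nrm_self]
    rcases lt_or_gt_of_ne (show φ ≠ θ from hne) with hlt | hlt
    · have : offset K α φ < inner ℝ (pt θ ((m - c) / 2) h) (nrm φ) := by
        rw [hK.offset_lt_iff hα]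
        by_contra! hcon
        exact h1.not_ge (div_nonneg_of_nonpos (by linarith) (by linarith))
      exact div_lt_div_of_neg_of_lt (by linarith) (by linarith)
    · have : inner ℝ (pt θ ((m - c) / 2) h) (nrm φ) < offset K α φ := by
        rw [← not_le, hK.offset_le_iff hα]
        intro hcon
        exact h1.not_ge (div_nonneg (by linarith) (by linarith))
      exact div_lt_div_of_pos_right (by linarith) (by linarith)
  · have hc : -m < c := hc
    have h1 := (hasDerivAt_iff_tendsto_slope.1 (harea ((m - c) / 2))).eventually_const_lt
      (show (0 : ℝ) < _ from mul_pos hL (by linarith))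
    have h2 := (hasDerivAt_iff_tendsto_slope.1 (hline ((m - c) / 2))).eventually_lt_const
      (show _ < c by linarith)
    filter_upwards [h1, h2, self_mem_nhdsWithin] with φ h1 h2 hne
    refine lt_trans ?_ h2
    rw [slope_def_field, hself] at h1
    rw [slope_def_field, slope_def_field, inner_pt_nrm_self]
    rcases lt_or_gt_of_ne (show φ ≠ θ from hne) with hlt | hlt
    · have : inner ℝ (pt θ ((m - c) / 2) h) (nrm φ) < offset K α φ := by
        rw [← not_le, hK.offset_le_iff hα]
        intro hcon
        exact h1.not_ge (div_nonpos_of_nonneg_of_nonpos (by linarith) (by linarith))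
      exact div_lt_div_of_neg_of_lt (by linarith) (by linarith)
    · have : offset K α φ < inner ℝ (pt θ ((m - c) / 2) h) (nrm φ) := by
        rw [hK.offset_lt_iff hα]
        by_contra! hcon
        exact h1.not_ge (div_nonpos_of_nonpos_of_nonneg (by linarith) (by linarith))
      exact div_lt_div_of_pos_right (by linarith) (by linarith)

/-! ### One-sided derivatives of the chord ends and of the midpoint -/

lemma hasDerivAt_mul_of_eq_zero {r g : ℝ → ℝ} {g' x : ℝ} (hr : ContinuousAt r x)
    (hg : HasDerivAt g g' x) (h0 : g x = 0) : HasDerivAt (fun y => r y * g y) (r x * g') x := by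
  rw [hasDerivAt_iff_tendsto_slope] at hg ⊢
  refine ((hr.tendsto.mono_left nhdsWithin_le_nhds).mul hg).congr fun y => ?_
  simp only [slope_def_field, h0]
  ring

section EndPoint

variable {δ θ h' : ℝ} {h : ℝ → ℝ}

/-- The last point of `K` on the line of direction `φ + δ` and offset `h φ`. -/
def lastPt (K : Set Plane) (δ : ℝ) (h : ℝ → ℝ) (φ : ℝ) : Plane :=
  pt (φ + δ) (reach K (φ + δ) (h φ)) (h φ)

lemma IsBody.continuousAt_reach_comp (hK : IsBody K) (hm : Meets K (θ + δ) (h θ))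
    (hh : ContinuousAt h θ) : ContinuousAt (fun φ => reach K (φ + δ) (h φ)) θ :=
  ContinuousAt.comp (f := fun φ => (φ + δ, h φ)) (g := fun p : ℝ × ℝ => reach K p.1 p.2)
    (hK.continuousAt_reach hm) (by fun_prop)

lemma IsBody.continuousAt_lastPt (hK : IsBody K) (hm : Meets K (θ + δ) (h θ))
    (hh : ContinuousAt h θ) : ContinuousAt (lastPt K δ h) θ := by
  have h1 := hK.continuousAt_reach_comp hm hh
  exact ContinuousAt.comp (f := fun φ => (φ + δ, reach K (φ + δ) (h φ), h φ))
    (g := fun p : ℝ × ℝ × ℝ => pt p.1 p.2.1 p.2.2)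
    (by fun_prop : Continuous fun p : ℝ × ℝ × ℝ => pt p.1 p.2.1 p.2.2).continuousAt
    (by fun_prop)

/-- The ordinate of the last point in the fixed frame of direction `θ + δ` is differentiable: this
only uses the continuity of its abscissa. -/
lemma IsBody.hasDerivAt_ordinate (hK : IsBody K) (hm : Meets K (θ + δ) (h θ))
    (hh : HasDerivAt h h' θ) :
    HasDerivAt (fun φ => (inner ℝ (lastPt K δ h φ) (nrm (θ + δ)) : ℝ))
      (reach K (θ + δ) (h θ) + h') θ := by
  have hs : HasDerivAt (fun φ => sin (φ - θ)) 1 θ :=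
    ((hasDerivAt_id θ).sub_const θ).sin.congr_deriv (by simp)
  have hc : HasDerivAt (fun φ => cos (φ - θ)) 0 θ :=
    ((hasDerivAt_id θ).sub_const θ).cos.congr_deriv (by simp)
  have h1 := hasDerivAt_mul_of_eq_zero (hK.continuousAt_reach_comp hm hh.continuousAt) hs (by simp)
  have h2 := (h1.add (hh.mul hc)).congr_deriv
    (show _ = reach K (θ + δ) (h θ) + h' by simp)
  refine h2.congr_of_eventuallyEq (Eventually.of_forall fun φ => ?_)
  simp only [lastPt, inner_pt_nrm, add_sub_add_right_eq_sub]
  rfl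

/-- Near `θ`, the last point on the rotated line is also the last point of `K` on its own parallel
to the line of direction `θ + δ`. -/
lemma IsBody.eventually_abscissa_eq (hK : IsBody K) (hm : Meets K (θ + δ) (h θ))
    (hh : ContinuousAt h θ) : ∀ᶠ φ in 𝓝 θ, (inner ℝ (lastPt K δ h φ) (dir (θ + δ)) : ℝ) =
      reach K (θ + δ) (inner ℝ (lastPt K δ h φ) (nrm (θ + δ))) := by
  have hcont := hK.continuousAt_lastPt hm hh
  have hy : ContinuousAt (fun φ => (inner ℝ (lastPt K δ h φ) (nrm (θ + δ)) : ℝ)) θ :=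
    hcont.inner continuousAt_const
  have hx : ContinuousAt (fun φ => (inner ℝ (lastPt K δ h φ) (dir (θ + δ)) : ℝ)) θ :=
    hcont.inner continuousAt_const
  have hy0 : (inner ℝ (lastPt K δ h θ) (nrm (θ + δ)) : ℝ) = h θ := by simp [lastPt]
  have hx0 : (inner ℝ (lastPt K δ h θ) (dir (θ + δ)) : ℝ) = reach K (θ + δ) (h θ) := by
    simp [lastPt]
  have e1 : ∀ᶠ φ in 𝓝 θ, Meets K (φ + δ) (h φ) :=
    (by fun_prop : ContinuousAt (fun φ => (φ + δ, h φ)) θ).eventually hm.eventually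
  have e2 : ∀ᶠ φ in 𝓝 θ, Meets K (θ + δ) (inner ℝ (lastPt K δ h φ) (nrm (θ + δ))) := by
    have hp : Tendsto (fun φ => (θ + δ, (inner ℝ (lastPt K δ h φ) (nrm (θ + δ)) : ℝ))) (𝓝 θ)
        (𝓝 (θ + δ, h θ)) := tendsto_const_nhds.prodMk_nhds (hy0 ▸ hy.tendsto)
    exact hp.eventually hm.eventually
  have e3 : ∀ᶠ φ in 𝓝 θ, -reach K (θ + δ + π) (-(inner ℝ (lastPt K δ h φ) (nrm (θ + δ)))) <
      (inner ℝ (lastPt K δ h φ) (dir (θ + δ)) : ℝ) := by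
    refine ContinuousAt.eventually_lt (ContinuousAt.neg ?_) hx ?_
    · refine ContinuousAt.comp (f := fun φ => (θ + δ + π, -(inner ℝ (lastPt K δ h φ)
        (nrm (θ + δ)) : ℝ))) (g := fun p : ℝ × ℝ => reach K p.1 p.2) ?_
        (continuousAt_const.prodMk hy.neg)
      simp only [hy0]
      exact hK.continuousAt_reach hm.add_pi
    · rw [hy0, hx0]
      exact hK.neg_reach_lt_reach hm
  filter_upwards [e1, e2, e3] with φ e1 e2 e3
  have hmem : lastPt K δ h φ ∈ K := hK.reach_mem_of_meets e1
  refine le_antisymm (hK.le_reach (by rwa [pt_inner])) ?_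
  -- otherwise this last point would be interior to `K`
  by_contra! hlt
  have hin := hK.mem_interior e2 e3 hlt
  rw [pt_inner] at hin
  exact (hK.lt_reach hin).false

lemma IsBody.hasDerivWithinAt_lastPt (hK : IsBody K) (hm : Meets K (θ + δ) (h θ))
    (hh : HasDerivAt h h' θ) {s s' : Set ℝ} {r : ℝ}
    (hr : HasDerivWithinAt (reach K (θ + δ)) r s' (h θ))
    (hs : ∀ᶠ φ in 𝓝[s] θ, (inner ℝ (lastPt K δ h φ) (nrm (θ + δ)) : ℝ) ∈ s') :
    HasDerivWithinAt (lastPt K δ h)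
      (pt (θ + δ) (r * (reach K (θ + δ) (h θ) + h')) (reach K (θ + δ) (h θ) + h')) s θ := by
  have hy := hK.hasDerivAt_ordinate hm hh
  have hy0 : (inner ℝ (lastPt K δ h θ) (nrm (θ + δ)) : ℝ) = h θ := by simp [lastPt]
  have hx : HasDerivWithinAt (fun φ => (inner ℝ (lastPt K δ h φ) (dir (θ + δ)) : ℝ))
      (r * (reach K (θ + δ) (h θ) + h')) s θ := by
    have h1 : HasDerivWithinAt (reach K (θ + δ) ∘
        fun φ => (inner ℝ (lastPt K δ h φ) (nrm (θ + δ)) : ℝ))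
        (r * (reach K (θ + δ) (h θ) + h'))
        (s ∩ {φ | (inner ℝ (lastPt K δ h φ) (nrm (θ + δ)) : ℝ) ∈ s'}) θ :=
      HasDerivWithinAt.comp θ (by rwa [hy0]) hy.hasDerivWithinAt fun φ hφ => hφ.2
    have h2 := h1.mono_of_mem_nhdsWithin (inter_mem self_mem_nhdsWithin hs)
    have h3 := hK.eventually_abscissa_eq hm hh.continuousAt
    exact h2.congr_of_eventuallyEq (h3.filter_mono nhdsWithin_le_nhds) h3.self_of_nhds
  refine ((hx.smul_const (dir (θ + δ))).add
    (hy.hasDerivWithinAt.smul_const (nrm (θ + δ)))).congr_of_eventuallyEq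
    (Eventually.of_forall fun φ => ?_) ?_
  · exact (pt_inner (θ + δ) _).symm
  · exact (pt_inner (θ + δ) _).symm

end EndPoint

lemma mid_eq_lastPt (K : Set Plane) (α θ : ℝ) : mid K α θ =
    (1 / 2 : ℝ) • (lastPt K π (fun φ => -offset K α φ) θ + lastPt K 0 (offset K α) θ) := by
  have h1 : chordStart K α θ = lastPt K π (fun φ => -offset K α φ) θ := by
    rw [lastPt, pt_add_pi, neg_neg, ← sInf_fiber]
    rfl
  have h2 : chordEnd K α θ = lastPt K 0 (offset K α) θ := by
    rw [lastPt, add_zero]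
    rfl
  rw [mid, midpoint_eq_smul_add, h1, h2, one_div, invOf_eq_inv]

lemma mid_eq_pt (K : Set Plane) (α θ : ℝ) :
    mid K α θ = pt θ (midAbs K α θ) (offset K α θ) := by
  rw [mid_eq_lastPt, lastPt, lastPt, pt_add_pi, add_zero, neg_neg]
  unfold pt midAbs
  module

/-- Half the length of the `α`-section of direction `θ`. -/
def halfLength (K : Set Plane) (α θ : ℝ) : ℝ :=
  (reach K θ (offset K α θ) + reach K (θ + π) (-offset K α θ)) / 2

lemma IsBody.halfLength_pos (hK : IsBody K) {α : ℝ} (hα : α ∈ Ioo (0 : ℝ) 1) (θ : ℝ) :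
    0 < halfLength K α θ := by
  have := hK.neg_reach_lt_reach (hK.meets_offset hα θ)
  unfold halfLength
  linarith

/-- The end of the `α`-section moves to the left of the section at a positive rate, and its
initial endpoint moves to the right at the same rate. -/
lemma IsBody.hasDerivAt_ordinates (hK : IsBody K) {α : ℝ} (hα : α ∈ Ioo (0 : ℝ) 1) (θ : ℝ) :
    HasDerivAt (fun φ => (inner ℝ (lastPt K 0 (offset K α) φ) (nrm (θ + 0)) : ℝ))
      (halfLength K α θ) θ ∧
    HasDerivAt (fun φ => (inner ℝ (lastPt K π (fun φ => -offset K α φ) φ) (nrm (θ + π)) : ℝ))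
      (halfLength K α θ) θ := by
  have hm := hK.meets_offset hα θ
  have hd := hK.hasDerivAt_offset hα θ
  have hd' : HasDerivAt (fun φ => -offset K α φ) (midAbs K α θ) θ :=
    hd.neg.congr_deriv (neg_neg _)
  have h1 := hK.hasDerivAt_ordinate (δ := 0) (by simpa using hm) hd
  have h2 := hK.hasDerivAt_ordinate (δ := π) hm.add_pi hd'
  refine ⟨h1.congr_deriv ?_, h2.congr_deriv ?_⟩ <;> simp only [halfLength, midAbs, add_zero] <;>
    ring

lemma IsBody.hasDerivWithinAt_mid (hK : IsBody K) {α : ℝ} (hα : α ∈ Ioo (0 : ℝ) 1) {θ : ℝ}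
    {s s₁ s₂ : Set ℝ} {r₁ r₂ : ℝ}
    (hr₁ : HasDerivWithinAt (reach K θ) r₁ s₁ (offset K α θ))
    (hr₂ : HasDerivWithinAt (reach K (θ + π)) r₂ s₂ (-offset K α θ))
    (h₁ : ∀ᶠ φ in 𝓝[s] θ, (inner ℝ (lastPt K 0 (offset K α) φ) (nrm (θ + 0)) : ℝ) ∈ s₁)
    (h₂ : ∀ᶠ φ in 𝓝[s] θ,
      (inner ℝ (lastPt K π (fun φ => -offset K α φ) φ) (nrm (θ + π)) : ℝ) ∈ s₂) :
    HasDerivWithinAt (mid K α) ((halfLength K α θ / 2 * (r₁ - r₂)) • dir θ) s θ := by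
  have hm := hK.meets_offset hα θ
  have hd := hK.hasDerivAt_offset hα θ
  have hd' : HasDerivAt (fun φ => -offset K α φ) (midAbs K α θ) θ :=
    hd.neg.congr_deriv (neg_neg _)
  have d1 := hK.hasDerivWithinAt_lastPt (δ := 0) (by simpa using hm) hd (by simpa using hr₁) h₁
  have d2 := hK.hasDerivWithinAt_lastPt (δ := π) hm.add_pi hd' hr₂ h₂
  have d := ((d2.add d1).const_smul (1 / 2 : ℝ))
  refine (d.congr_deriv ?_).congr_of_eventuallyEq
    (Eventually.of_forall fun φ => mid_eq_lastPt K α φ) (mid_eq_lastPt K α θ)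
  rw [pt_add_pi]
  simp only [pt, halfLength, midAbs, add_zero]
  module

/-- The right derivative of `reach K θ`. -/
def rightSlope (K : Set Plane) (θ t : ℝ) : ℝ := derivWithin (reach K θ) (Ioi t) t

/-- The left derivative of `reach K θ`. -/
def leftSlope (K : Set Plane) (θ t : ℝ) : ℝ := derivWithin (reach K θ) (Iio t) t

lemma IsBody.hasDerivWithinAt_rightSlope (hK : IsBody K) {θ t : ℝ} (h : Meets K θ t) :
    HasDerivWithinAt (reach K θ) (rightSlope K θ t) (Ioi t) t := by
  have := ((hK.concaveOn_reach θ).neg.differentiableWithinAt_Ioi_of_mem_interior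
    h.mem_interior_shadow).neg
  rw [neg_neg] at this
  exact this.hasDerivWithinAt

lemma IsBody.hasDerivWithinAt_leftSlope (hK : IsBody K) {θ t : ℝ} (h : Meets K θ t) :
    HasDerivWithinAt (reach K θ) (leftSlope K θ t) (Iio t) t := by
  have := ((hK.concaveOn_reach θ).neg.differentiableWithinAt_Iio_of_mem_interior
    h.mem_interior_shadow).neg
  rw [neg_neg] at this
  exact this.hasDerivWithinAt

lemma eventually_lt_of_hasDerivAt_pos {f : ℝ → ℝ} {f' x : ℝ} (h : HasDerivAt f f' x) (h0 : 0 < f') :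
    (∀ᶠ y in 𝓝[>] x, f x < f y) ∧ ∀ᶠ y in 𝓝[<] x, f y < f x := by
  have h1 := (hasDerivAt_iff_tendsto_slope.1 h).eventually_const_lt h0
  refine ⟨?_, ?_⟩
  · filter_upwards [h1.filter_mono (nhdsGT_le_nhdsNE x), self_mem_nhdsWithin] with y hy hxy
    exact (slope_pos_iff_of_le (le_of_lt hxy)).1 hy
  · filter_upwards [h1.filter_mono (nhdsLT_le_nhdsNE x), self_mem_nhdsWithin] with y hy hxy
    rw [slope_comm] at hy
    exact (slope_pos_iff_of_le (le_of_lt hxy)).1 hy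

lemma IsBody.hasDerivWithinAt_mid_Ioi (hK : IsBody K) {α : ℝ} (hα : α ∈ Ioo (0 : ℝ) 1) (θ : ℝ) :
    HasDerivWithinAt (mid K α) ((halfLength K α θ / 2 * (rightSlope K θ (offset K α θ) -
      rightSlope K (θ + π) (-offset K α θ))) • dir θ) (Ioi θ) θ := by
  have hm := hK.meets_offset hα θ
  obtain ⟨d1, d2⟩ := hK.hasDerivAt_ordinates hα θ
  have hp := hK.halfLength_pos hα θ
  refine hK.hasDerivWithinAt_mid hα (hK.hasDerivWithinAt_rightSlope hm)
    (hK.hasDerivWithinAt_rightSlope hm.add_pi) ?_ ?_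
  · simpa [lastPt] using (eventually_lt_of_hasDerivAt_pos d1 hp).1
  · simpa [lastPt] using (eventually_lt_of_hasDerivAt_pos d2 hp).1

lemma IsBody.hasDerivWithinAt_mid_Iio (hK : IsBody K) {α : ℝ} (hα : α ∈ Ioo (0 : ℝ) 1) (θ : ℝ) :
    HasDerivWithinAt (mid K α) ((halfLength K α θ / 2 * (leftSlope K θ (offset K α θ) -
      leftSlope K (θ + π) (-offset K α θ))) • dir θ) (Iio θ) θ := by
  have hm := hK.meets_offset hα θ
  obtain ⟨d1, d2⟩ := hK.hasDerivAt_ordinates hα θ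
  have hp := hK.halfLength_pos hα θ
  refine hK.hasDerivWithinAt_mid hα (hK.hasDerivWithinAt_leftSlope hm)
    (hK.hasDerivWithinAt_leftSlope hm.add_pi) ?_ ?_
  · simpa [lastPt] using (eventually_lt_of_hasDerivAt_pos d1 hp).2
  · simpa [lastPt] using (eventually_lt_of_hasDerivAt_pos d2 hp).2

lemma IsBody.isEnvelope (hK : IsBody K) {α : ℝ} (hα : α ∈ Ioo (0 : ℝ) 1) :
    IsEnvelope (offset K α) (mid K α) := fun θ =>
  ⟨by simp [line, mid_eq_pt], ⟨_, hK.hasDerivWithinAt_mid_Iio hα θ⟩,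
    ⟨_, hK.hasDerivWithinAt_mid_Ioi hα θ⟩⟩

lemma inner_dir_self (θ : ℝ) : (inner ℝ (dir θ) (dir θ) : ℝ) = 1 := by
  simp [norm_dir]

lemma IsBody.velR_eq (hK : IsBody K) {α : ℝ} (hα : α ∈ Ioo (0 : ℝ) 1) (θ : ℝ) :
    velR K α θ = halfLength K α θ / 2 * (rightSlope K θ (offset K α θ) -
      rightSlope K (θ + π) (-offset K α θ)) := by
  rw [velR, (hK.hasDerivWithinAt_mid_Ioi hα θ).derivWithin (uniqueDiffWithinAt_Ioi θ),
    real_inner_smul_left, inner_dir_self, mul_one]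

lemma IsBody.velL_eq (hK : IsBody K) {α : ℝ} (hα : α ∈ Ioo (0 : ℝ) 1) (θ : ℝ) :
    velL K α θ = halfLength K α θ / 2 * (leftSlope K θ (offset K α θ) -
      leftSlope K (θ + π) (-offset K α θ)) := by
  rw [velL, (hK.hasDerivWithinAt_mid_Iio hα θ).derivWithin (uniqueDiffWithinAt_Iio θ),
    real_inner_smul_left, inner_dir_self, mul_one]

lemma mem_backwards {α θ : ℝ} : θ ∈ backwards K α ↔ velL K α θ < 0 ∨ velR K α θ < 0 := by
  constructor
  · rintro ⟨x, hx, hx0⟩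
    by_contra! hcon
    exact (show x < 0 from hx0).not_ge ((le_min hcon.1 hcon.2).trans hx.1)
  · rintro (h | h)
    · exact ⟨_, left_mem_uIcc, h⟩
    · exact ⟨_, right_mem_uIcc, h⟩

lemma IsBody.rightSlope_anti (hK : IsBody K) {θ t t' : ℝ} (h : Meets K θ t) (h' : Meets K θ t')
    (htt : t ≤ t') : rightSlope K θ t' ≤ rightSlope K θ t := by
  have := (hK.concaveOn_reach θ).neg.monotoneOn_rightDeriv h.mem_interior_shadow
    h'.mem_interior_shadow htt
  simpa [derivWithin.neg, rightSlope] using this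

lemma IsBody.leftSlope_anti (hK : IsBody K) {θ t t' : ℝ} (h : Meets K θ t) (h' : Meets K θ t')
    (htt : t ≤ t') : leftSlope K θ t' ≤ leftSlope K θ t := by
  have := (hK.concaveOn_reach θ).neg.monotoneOn_leftDeriv h.mem_interior_shadow
    h'.mem_interior_shadow htt
  simpa [derivWithin.neg, leftSlope] using this

/-- The sign of the velocities is that of the difference of the slopes of the two arcs of the
boundary at the ends of the section, which decreases as the section moves to the left. -/
lemma IsBody.backwards_subset (hK : IsBody K) {α β : ℝ} (hα : α ∈ Ioo (0 : ℝ) 1)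
    (hβ : β ∈ Ioo (0 : ℝ) 1) (h : α ≤ β) : backwards K α ⊆ backwards K β := by
  intro θ hθ
  have hle : offset K α θ ≤ offset K β θ := by
    rcases h.eq_or_lt with rfl | h
    · exact le_rfl
    · exact (hK.offset_lt_offset hα hβ h θ).le
  have mα := hK.meets_offset hα θ
  have mβ := hK.meets_offset hβ θ
  have lα := hK.halfLength_pos hα θ
  have lβ := hK.halfLength_pos hβ θ
  rw [mem_backwards] at hθ ⊢
  rw [hK.velL_eq hα, hK.velR_eq hα] at hθ
  rw [hK.velL_eq hβ, hK.velR_eq hβ]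
  refine hθ.imp (fun hneg => ?_) fun hneg => ?_
  · have h1 := hK.leftSlope_anti mα mβ hle
    have h2 := hK.leftSlope_anti mβ.add_pi mα.add_pi (neg_le_neg hle)
    have h3 := (pos_iff_neg_of_mul_neg hneg).1 (by linarith)
    exact mul_neg_of_pos_of_neg (by linarith) (by linarith)
  · have h1 := hK.rightSlope_anti mα mβ hle
    have h2 := hK.rightSlope_anti mβ.add_pi mα.add_pi (neg_le_neg hle)
    have h3 := (pos_iff_neg_of_mul_neg hneg).1 (by linarith)
    exact mul_neg_of_pos_of_neg (by linarith) (by linarith)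

/-! ### The core -/

/-- The least area that a line through `x` cuts off from `K`. The directions run over a full turn, so
both sides of each line are taken into account. -/
def depth (K : Set Plane) (x : Plane) : ℝ :=
  sInf ((fun θ => area K θ (inner ℝ x (nrm θ))) '' Icc 0 (2 * π))

lemma continuous_area_through (hK : IsCompact K) :
    Continuous fun p : Plane × ℝ => area K p.2 (inner ℝ p.1 (nrm p.2)) :=
  (continuous_area hK).comp (f := fun p : Plane × ℝ => (p.2, (inner ℝ p.1 (nrm p.2) : ℝ)))
    (by fun_prop)

lemma continuous_depth (hK : IsCompact K) : Continuous (depth K) :=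
  isCompact_Icc.continuous_sInf (f := fun x θ => area K θ (inner ℝ x (nrm θ)))
    (continuous_area_through hK)

lemma depth_spec (hK : IsCompact K) (x : Plane) :
    (∃ θ, area K θ (inner ℝ x (nrm θ)) = depth K x) ∧
      ∀ θ, depth K x ≤ area K θ (inner ℝ x (nrm θ)) := by
  have hc : Continuous fun θ => area K θ (inner ℝ x (nrm θ)) :=
    (continuous_area_through hK).comp (f := fun θ => (x, θ)) (by fun_prop)
  have hne : (Icc 0 (2 * π)).Nonempty := ⟨0, le_rfl, by positivity⟩
  obtain ⟨θ, -, hθ, hmin⟩ := isCompact_Icc.exists_sInf_image_eq_and_le hne hc.continuousOn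
  refine ⟨⟨θ, hθ.symm⟩, fun φ => ?_⟩
  have hper : Function.Periodic (fun θ => area K θ (inner ℝ x (nrm θ))) (2 * π) := fun θ => by
    simp [area, rightHalf, nrm_periodic θ]
  obtain ⟨ψ, hψ, he⟩ := hper.exists_mem_Ico₀ (by positivity) φ
  rw [he]
  exact hθ.trans_le (hmin ψ (Ico_subset_Icc_self hψ))

lemma IsBody.mem_core_iff (hK : IsBody K) {α : ℝ} (hα : α ∈ Ioo (0 : ℝ) 1) {x : Plane} :
    x ∈ core K α ↔ ∀ θ, offset K α θ ≤ inner ℝ x (nrm θ) := by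
  refine ⟨fun h θ => h θ _ (hK.area_offset hα θ), fun h θ t ht => ?_⟩
  rw [hK.isSection_iff hα] at ht
  rw [ht]
  exact h θ

/-- The core is a superlevel set of the depth. -/
lemma IsBody.mem_core_iff_depth (hK : IsBody K) {α : ℝ} (hα : α ∈ Ioo (0 : ℝ) 1) {x : Plane} :
    x ∈ core K α ↔ α * volume.real K ≤ depth K x := by
  obtain ⟨⟨θ, hθ⟩, hle⟩ := depth_spec hK.isCompact x
  simp only [hK.mem_core_iff hα, hK.offset_le_iff hα]
  exact ⟨fun h => hθ ▸ h θ, fun h φ => h.trans (hle φ)⟩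

lemma IsBody.isClosed_core (hK : IsBody K) {α : ℝ} (hα : α ∈ Ioo (0 : ℝ) 1) :
    IsClosed (core K α) := by
  have : core K α = {x | α * volume.real K ≤ depth K x} := by
    ext x; exact hK.mem_core_iff_depth hα
  rw [this]
  exact isClosed_le continuous_const (continuous_depth hK.isCompact)

lemma IsBody.offset_lt_of_mem_interior_core (hK : IsBody K) {α : ℝ} (hα : α ∈ Ioo (0 : ℝ) 1)
    {x : Plane} (hx : x ∈ interior (core K α)) (θ : ℝ) : offset K α θ < inner ℝ x (nrm θ) := by
  have hc : ContinuousAt (fun ε : ℝ => x - ε • nrm θ) 0 := by fun_prop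
  have h1 : ∀ᶠ ε in 𝓝[>] (0 : ℝ), x - ε • nrm θ ∈ interior (core K α) :=
    (hc.mono_left nhdsWithin_le_nhds).eventually (isOpen_interior.mem_nhds (by simpa using hx))
  obtain ⟨ε, h1, h2⟩ := (h1.and self_mem_nhdsWithin).exists
  have h2 : 0 < ε := h2
  have h3 := (hK.mem_core_iff hα).1 (interior_subset h1) θ
  rw [inner_sub_left, real_inner_smul_left, real_inner_self_eq_norm_sq, norm_nrm] at h3
  linarith

lemma IsBody.mem_interior_core_iff (hK : IsBody K) {α : ℝ} (hα : α ∈ Ioo (0 : ℝ) 1) {x : Plane} :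
    x ∈ interior (core K α) ↔ α * volume.real K < depth K x := by
  refine ⟨fun h => ?_, fun h => ?_⟩
  · obtain ⟨⟨θ, hθ⟩, -⟩ := depth_spec hK.isCompact x
    rw [← hθ, ← hK.offset_lt_iff hα]
    exact hK.offset_lt_of_mem_interior_core hα h θ
  · rw [_root_.mem_interior]
    refine ⟨{y | α * volume.real K < depth K y}, fun y hy => ?_,
      isOpen_lt continuous_const (continuous_depth hK.isCompact), h⟩
    exact (hK.mem_core_iff_depth hα).2 (le_of_lt hy)

/-- A point of the core that lies on a section is the midpoint of this section, because
`⟨x, u'(φ)⟩ - offset K α φ` is minimal, hence critical, at this direction. -/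
lemma IsBody.eq_mid_of_mem_core (hK : IsBody K) {α : ℝ} (hα : α ∈ Ioo (0 : ℝ) 1) {x : Plane}
    (hx : x ∈ core K α) {θ : ℝ} (h : inner ℝ x (nrm θ) = offset K α θ) : x = mid K α θ := by
  rw [hK.mem_core_iff hα] at hx
  have hd : HasDerivAt (fun φ => (inner ℝ x (nrm φ) : ℝ) - offset K α φ)
      (-inner ℝ x (dir θ) - -midAbs K α θ) θ := by
    refine HasDerivAt.sub ?_ (hK.hasDerivAt_offset hα θ)
    simp only [inner_nrm]
    refine (((hasDerivAt_cos θ).const_mul (x 1)).sub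
      ((hasDerivAt_sin θ).const_mul (x 0))).congr_deriv ?_
    rw [inner_dir]
    ring
  have hmin : IsLocalMin (fun φ => (inner ℝ x (nrm φ) : ℝ) - offset K α φ) θ :=
    Eventually.of_forall fun φ => by
      simp only [h, sub_self, sub_nonneg]
      exact hx φ
  have h0 := hmin.hasDerivAt_eq_zero hd
  rw [mid_eq_pt, ← pt_inner θ x, h]
  congr 1
  linarith

/-- The minimum over the directions that defines the depth is attained, so a boundary point of the
core lies on some section. -/
lemma IsBody.exists_inner_nrm_eq_offset (hK : IsBody K) {α : ℝ} (hα : α ∈ Ioo (0 : ℝ) 1) {x : Plane}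
    (hx : x ∈ core K α) (hx' : x ∉ interior (core K α)) :
    ∃ θ, inner ℝ x (nrm θ) = offset K α θ := by
  rw [hK.mem_interior_core_iff hα, not_lt] at hx'
  have h := le_antisymm ((hK.mem_core_iff_depth hα).1 hx) hx'
  obtain ⟨⟨θ, hθ⟩, -⟩ := depth_spec hK.isCompact x
  exact ⟨θ, (hK.isSection_iff hα).1 (hθ.trans h.symm)⟩

lemma IsBody.strictConvex_core (hK : IsBody K) {α : ℝ} (hα : α ∈ Ioo (0 : ℝ) 1) :
    StrictConvex ℝ (core K α) := by
  intro x hx y hy hxy a b ha hb hab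
  have hx' := (hK.mem_core_iff hα).1 hx
  have hy' := (hK.mem_core_iff hα).1 hy
  have hexp : ∀ θ, (inner ℝ (a • x + b • y) (nrm θ) : ℝ) =
      a * inner ℝ x (nrm θ) + b * inner ℝ y (nrm θ) := fun θ => by
    rw [inner_add_left, real_inner_smul_left, real_inner_smul_left]
  have hz : a • x + b • y ∈ core K α := by
    rw [hK.mem_core_iff hα]
    intro θ
    rw [hexp]
    have := hx' θ
    have := hy' θ
    calc offset K α θ = a * offset K α θ + b * offset K α θ := by rw [← add_mul, hab, one_mul]
      _ ≤ _ := by gcongr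
  by_contra hni
  obtain ⟨θ, hθ⟩ := hK.exists_inner_nrm_eq_offset hα hz hni
  -- the section that supports the core at this point also passes through `x` and `y`
  rw [hexp] at hθ
  have e : a * (inner ℝ x (nrm θ) - offset K α θ) + b * (inner ℝ y (nrm θ) - offset K α θ) = 0 := by
    linear_combination hθ - offset K α θ * hab
  have px := mul_nonneg ha.le (sub_nonneg.2 (hx' θ))
  have py := mul_nonneg hb.le (sub_nonneg.2 (hy' θ))
  have ex : inner ℝ x (nrm θ) - offset K α θ = 0 :=
    (mul_eq_zero.1 (by linarith)).resolve_left ha.ne'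
  have ey : inner ℝ y (nrm θ) - offset K α θ = 0 :=
    (mul_eq_zero.1 (by linarith)).resolve_left hb.ne'
  exact hxy ((hK.eq_mid_of_mem_core hα hx (sub_eq_zero.1 ex)).trans
    (hK.eq_mid_of_mem_core hα hy (sub_eq_zero.1 ey)).symm)

lemma IsBody.depth_le_half (hK : IsBody K) (x : Plane) : depth K x ≤ volume.real K / 2 := by
  obtain ⟨-, h⟩ := depth_spec hK.isCompact x
  have h1 := h 0
  have h2 := h (0 + π)
  rw [nrm_add_pi, inner_neg_right, area_add_pi hK.isCompact] at h2
  linarith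

lemma IsBody.depth_pos (hK : IsBody K) {x : Plane} (hx : x ∈ interior K) : 0 < depth K x := by
  obtain ⟨⟨θ, hθ⟩, -⟩ := depth_spec hK.isCompact x
  rw [← hθ]
  exact area_pos_of_mem hK.isCompact hx le_rfl

/-- Some point has maximal depth. -/
lemma IsBody.exists_forall_depth_le (hK : IsBody K) : ∃ p, ∀ x, depth K x ≤ depth K p := by
  obtain ⟨R, hR⟩ := hK.exists_radius
  obtain ⟨x₀, hx₀⟩ := hK.nonempty
  have h0 := hK.depth_pos hx₀
  have hball : x₀ ∈ Metric.closedBall (0 : Plane) R := by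
    simpa using hR _ (interior_subset hx₀)
  obtain ⟨p, -, hp⟩ := (isCompact_closedBall (0 : Plane) R).exists_isMaxOn ⟨x₀, hball⟩
    (continuous_depth hK.isCompact).continuousOn
  refine ⟨p, fun x => ?_⟩
  by_cases hx : x ∈ Metric.closedBall (0 : Plane) R
  · exact hp hx
  -- far from `K`, some line through `x` has all of `K` on its left
  have hx : R < ‖x‖ := by simpa using hx
  obtain ⟨θ, hθ⟩ := exists_smul_dir x
  have hin : (inner ℝ x (nrm (θ + π / 2)) : ℝ) = -‖x‖ := by
    conv_lhs => rw [hθ]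
    rw [real_inner_smul_left, inner_dir_nrm]
    simp
  refine le_trans ?_ (h0.le.trans (hp hball))
  refine ((depth_spec hK.isCompact x).2 (θ + π / 2)).trans_eq ?_
  rw [hin]
  exact (area_eq_of_radius hR _).1 (by linarith)

/-- The critical value is the maximal depth relative to the area of `K`. -/
lemma IsBody.exists_critical (hK : IsBody K) : ∃ αK : ℝ, 0 < αK ∧ αK ≤ 1 / 2 ∧
    (∀ α : ℝ, 0 < α → α < αK →
      StrictConvex ℝ (core K α) ∧ (interior (core K α)).Nonempty) ∧
    (∃ p : Plane, core K αK = {p}) ∧ (∀ α : ℝ, αK < α → α < 1 → core K α = ∅) := by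
  obtain ⟨p, hp⟩ := hK.exists_forall_depth_le
  obtain ⟨x₀, hx₀⟩ := hK.nonempty
  have hV := hK.volume_pos
  have hpos : 0 < depth K p := (hK.depth_pos hx₀).trans_le (hp x₀)
  have h1 : 0 < depth K p / volume.real K := div_pos hpos hV
  have h2 : depth K p / volume.real K ≤ 1 / 2 := by
    rw [div_le_iff₀ hV]
    linarith [hK.depth_le_half p]
  refine ⟨depth K p / volume.real K, h1, h2, fun α h0 hα => ?_, ⟨p, ?_⟩, fun α hα h3 => ?_⟩
  · have hα' : α ∈ Ioo (0 : ℝ) 1 := ⟨h0, by linarith⟩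
    exact ⟨hK.strictConvex_core hα', p, (hK.mem_interior_core_iff hα').2 ((lt_div_iff₀ hV).1 hα)⟩
  · have hα : depth K p / volume.real K ∈ Ioo (0 : ℝ) 1 := ⟨h1, by linarith⟩
    have hpc : p ∈ core K (depth K p / volume.real K) := by
      rw [hK.mem_core_iff_depth hα, div_mul_cancel₀ _ hV.ne']
    refine eq_singleton_iff_unique_mem.2 ⟨hpc, fun x hx => ?_⟩
    -- otherwise the midpoint of `x` and `p` would be interior to the core, hence deeper than `p`
    by_contra hne
    have hmid := hK.strictConvex_core hα hx hpc hne (a := 1 / 2) (b := 1 / 2)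
      (by norm_num) (by norm_num) (by norm_num)
    rw [hK.mem_interior_core_iff hα, div_mul_cancel₀ _ hV.ne'] at hmid
    exact hmid.not_ge (hp _)
  · have hα' : α ∈ Ioo (0 : ℝ) 1 := ⟨by linarith, h3⟩
    rw [eq_empty_iff_forall_notMem]
    intro x hx
    rw [hK.mem_core_iff_depth hα'] at hx
    have := (div_lt_iff₀ hV).1 hα
    linarith [hp x]

/-! ### The curve of midpoints and the boundary of the core -/

lemma mid_periodic (K : Set Plane) (α : ℝ) : Function.Periodic (mid K α) (2 * π) := by
  intro θ
  have : reach K (θ + 2 * π) = reach K θ := by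
    ext t
    rw [two_mul, ← add_assoc, reach_add_two_pi]
  have h' : reach K (θ + 2 * π + π) = reach K (θ + π) := by
    ext t
    rw [show θ + 2 * π + π = θ + π + π + π by ring, reach_add_two_pi]
  simp only [mid_eq_pt, midAbs, offset_periodic K α θ, this, h', pt, dir_periodic θ,
    nrm_periodic θ]

lemma IsBody.continuous_mid (hK : IsBody K) {α : ℝ} (hα : α ∈ Ioo (0 : ℝ) 1) :
    Continuous (mid K α) := by
  rw [continuous_iff_continuousAt]
  intro θ
  rw [continuousAt_iff_continuous_left'_right']
  exact ⟨(hK.hasDerivWithinAt_mid_Iio hα θ).continuousWithinAt,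
    (hK.hasDerivWithinAt_mid_Ioi hα θ).continuousWithinAt⟩

lemma le_of_hasDerivWithinAt_Ioi_nonneg {f f' : ℝ → ℝ} {a b : ℝ} (hf : Continuous f)
    (hd : ∀ x, HasDerivWithinAt f (f' x) (Ioi x) x) (h0 : ∀ x ∈ Ico a b, 0 ≤ f' x) :
    ∀ x ∈ Icc a b, f a ≤ f x := by
  intro x hx
  have := image_le_of_deriv_right_le_deriv_boundary (f := fun x => -f x) (f' := fun x => -f' x)
    (B := fun _ => -f a) (B' := fun _ => 0) (a := a) (b := b) hf.neg.continuousOn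
    (fun y _ => ((hd y).neg).Ici_of_Ioi) le_rfl continuousOn_const
    (fun y _ => hasDerivWithinAt_const _ _ _) (fun y hy => neg_nonpos.2 (h0 y hy)) hx
  simpa using this

/-- If the midpoint never moves backwards, the curve of midpoints lies on the left of every
section. -/
lemma IsBody.mid_mem_core_of_backwards_eq_empty (hK : IsBody K) {α : ℝ} (hα : α ∈ Ioo (0 : ℝ) 1)
    (hB : backwards K α = ∅) (φ : ℝ) : mid K α φ ∈ core K α := by
  rw [hK.mem_core_iff hα]
  intro θ
  have hL : ∀ ψ, 0 ≤ velL K α ψ ∧ 0 ≤ velR K α ψ := fun ψ => by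
    have : ψ ∉ backwards K α := by rw [hB]; exact notMem_empty ψ
    rw [mem_backwards] at this
    push Not at this
    exact this
  have hcont := hK.continuous_mid hα
  have hself : (inner ℝ (mid K α θ) (nrm θ) : ℝ) = offset K α θ := by simp [mid_eq_pt]
  -- both half-turns away from `θ` move the midpoint to the left of the section of direction `θ`
  have right : ∀ x ∈ Icc θ (θ + π), offset K α θ ≤ inner ℝ (mid K α x) (nrm θ) := by
    rw [← hself]
    refine le_of_hasDerivWithinAt_Ioi_nonneg (f := fun x => (inner ℝ (mid K α x) (nrm θ) : ℝ))
      (f' := fun x => velR K α x * sin (x - θ)) (by fun_prop) (fun x => ?_) fun x hx => ?_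
    · have := ((hK.hasDerivWithinAt_mid_Ioi hα x).inner ℝ
        (hasDerivWithinAt_const x (Ioi x) (nrm θ)))
      refine this.congr_deriv ?_
      rw [← hK.velR_eq hα, inner_zero_right, zero_add, real_inner_smul_left, inner_dir_nrm]
    · exact mul_nonneg (hL x).2 (sin_nonneg_of_nonneg_of_le_pi (by linarith [hx.1])
        (by linarith [hx.2]))
  have left : ∀ x ∈ Icc (-θ) (-θ + π), offset K α θ ≤ inner ℝ (mid K α (-x)) (nrm θ) := by
    rw [← hself]
    conv in mid K α θ => rw [← neg_neg θ]
    refine le_of_hasDerivWithinAt_Ioi_nonneg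
      (f := fun x => (inner ℝ (mid K α (-x)) (nrm θ) : ℝ))
      (f' := fun x => velL K α (-x) * sin (x + θ)) (by fun_prop) (fun x => ?_) fun x hx => ?_
    · have h1 := ((hK.hasDerivWithinAt_mid_Iio hα (-x)).inner ℝ
        (hasDerivWithinAt_const (-x) (Iio (-x)) (nrm θ)))
      have h2 : HasDerivWithinAt (fun x : ℝ => -x) (-1) (Ioi x) x :=
        (hasDerivAt_neg x).hasDerivWithinAt
      have := HasDerivWithinAt.comp x h1 h2
        (fun y hy => show -y < -x from neg_lt_neg hy)
      refine this.congr_deriv ?_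
      rw [← hK.velL_eq hα, inner_zero_right, zero_add, real_inner_smul_left, inner_dir_nrm,
        ← neg_add', sin_neg]
      ring
    · exact mul_nonneg (hL _).1 (sin_nonneg_of_nonneg_of_le_pi (by linarith [hx.1])
        (by linarith [hx.2]))
  obtain ⟨ψ, hψ, he⟩ := (mid_periodic K α).exists_mem_Ico (by positivity) φ (θ - π)
  rw [he]
  rcases le_total θ ψ with h | h
  · exact right ψ ⟨h, by linarith [hψ.2]⟩
  · simpa using left (-ψ) ⟨by linarith, by linarith [hψ.1]⟩

/-- If each midpoint lies on the left of every section, two nearby midpoints are in convex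
position with respect to their sections, so the midpoint never moves backwards. -/
lemma IsBody.backwards_eq_empty_of_mid_mem_core (hK : IsBody K) {α : ℝ} (hα : α ∈ Ioo (0 : ℝ) 1)
    (h : ∀ φ, mid K α φ ∈ core K α) : backwards K α = ∅ := by
  have hc : ∀ φ θ, offset K α θ ≤ inner ℝ (mid K α φ) (nrm θ) := fun φ =>
    (hK.mem_core_iff hα).1 (h φ)
  have hself : ∀ θ, (inner ℝ (mid K α θ) (nrm θ) : ℝ) = offset K α θ := fun θ => by
    simp [mid_eq_pt]
  -- the displacement between two nearby midpoints has the sign of the angle along `u(θ)`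
  have key : ∀ θ φ, cos (φ - θ) > 0 →
      0 ≤ sin (φ - θ) * inner ℝ (mid K α φ - mid K α θ) (dir θ) := by
    intro θ φ hcos
    have h1 := hc φ θ
    have h2 := hc θ φ
    rw [← hself θ, ← sub_nonneg, ← inner_sub_left] at h1
    rw [← hself φ, ← sub_nonpos, ← inner_sub_left] at h2
    set d := mid K α φ - mid K α θ
    rw [← pt_inner θ d, inner_pt_nrm, ← neg_sub φ θ, sin_neg, cos_neg] at h2
    nlinarith
  have hev : ∀ θ : ℝ, ∀ᶠ φ in 𝓝 θ, 0 < cos (φ - θ) ∧ |φ - θ| < π := fun θ => by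
    refine (continuousAt_const.eventually_lt
      (by fun_prop : ContinuousAt (fun φ => cos (φ - θ)) θ) (by simp)).and
      (ContinuousAt.eventually_lt (by fun_prop) continuousAt_const (by simp [pi_pos]))
  rw [eq_empty_iff_forall_notMem]
  intro θ hθ
  rw [mem_backwards, hK.velL_eq hα, hK.velR_eq hα] at hθ
  have slope_eq : ∀ s : Set ℝ, ∀ v : ℝ, θ ∉ s → HasDerivWithinAt (mid K α) (v • dir θ) s θ →
      Tendsto (fun φ => (φ - θ)⁻¹ * inner ℝ (mid K α φ - mid K α θ) (dir θ)) (𝓝[s] θ) (𝓝 v) := by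
    intro s v hs hd
    rw [hasDerivWithinAt_iff_tendsto_slope' hs] at hd
    have := hd.inner (𝕜 := ℝ) (tendsto_const_nhds (x := dir θ))
    rw [real_inner_smul_left, inner_dir_self, mul_one] at this
    refine this.congr fun φ => ?_
    rw [slope_def_module, real_inner_smul_left]
  rcases hθ with hθ | hθ
  · refine hθ.not_ge (ge_of_tendsto (slope_eq (Iio θ) _ (lt_irrefl θ)
      (hK.hasDerivWithinAt_mid_Iio hα θ)) ?_)
    filter_upwards [(hev θ).filter_mono nhdsWithin_le_nhds, self_mem_nhdsWithin] with φ h1 h2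
    have h2 : φ < θ := h2
    have hs : sin (φ - θ) < 0 := sin_neg_of_neg_of_neg_pi_lt (by linarith) (abs_lt.1 h1.2).1
    refine mul_nonneg_of_nonpos_of_nonpos (inv_nonpos.2 (by linarith)) ?_
    by_contra! hpos
    exact (key θ φ h1.1).not_gt (mul_neg_of_neg_of_pos hs hpos)
  · refine hθ.not_ge (ge_of_tendsto (slope_eq (Ioi θ) _ (lt_irrefl θ)
      (hK.hasDerivWithinAt_mid_Ioi hα θ)) ?_)
    filter_upwards [(hev θ).filter_mono nhdsWithin_le_nhds, self_mem_nhdsWithin] with φ h1 h2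
    have h2 : θ < φ := h2
    have hs : 0 < sin (φ - θ) := sin_pos_of_pos_of_lt_pi (by linarith) (abs_lt.1 h1.2).2
    refine mul_nonneg (inv_nonneg.2 (by linarith)) ?_
    by_contra! hneg
    exact (key θ φ h1.1).not_gt (mul_neg_of_pos_of_neg hs hneg)

lemma IsBody.midImage_eq_frontier_iff (hK : IsBody K) {α : ℝ} (hα : α ∈ Ioo (0 : ℝ) 1) :
    midImage K α = frontier (core K α) ↔ ∀ φ, mid K α φ ∈ core K α := by
  have hcl := hK.isClosed_core hα
  refine ⟨fun h φ => ?_, fun h => ?_⟩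
  · have : mid K α φ ∈ frontier (core K α) := h ▸ mem_range_self φ
    rw [hcl.frontier_eq] at this
    exact this.1
  · rw [hcl.frontier_eq]
    refine Subset.antisymm ?_ fun x hx => ?_
    · rintro _ ⟨φ, rfl⟩
      refine ⟨h φ, fun hi => ?_⟩
      have := hK.offset_lt_of_mem_interior_core hα hi φ
      simp [mid_eq_pt] at this
    · obtain ⟨θ, hθ⟩ := hK.exists_inner_nrm_eq_offset hα hx.1 hx.2
      exact ⟨θ, (hK.eq_mid_of_mem_core hα hx.1 hθ).symm⟩

lemma IsBody.continuousAt_mid_param (hK : IsBody K) {α : ℝ} (hα : α ∈ Ioo (0 : ℝ) 1) (θ : ℝ) :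
    ContinuousAt (fun β => mid K β θ) α := by
  have ho := hK.continuousAt_offset_param hα θ
  have hm := hK.meets_offset hα θ
  have h1 : ContinuousAt (fun β => reach K θ (offset K β θ)) α :=
    ContinuousAt.comp (f := fun β => (θ, offset K β θ)) (g := fun p : ℝ × ℝ => reach K p.1 p.2)
      (hK.continuousAt_reach hm) (continuousAt_const.prodMk ho)
  have h2 : ContinuousAt (fun β => reach K (θ + π) (-offset K β θ)) α :=
    ContinuousAt.comp (f := fun β => (θ + π, -offset K β θ))
      (g := fun p : ℝ × ℝ => reach K p.1 p.2)
      (hK.continuousAt_reach hm.add_pi) (continuousAt_const.prodMk ho.neg)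
  simp only [mid_eq_pt, midAbs, pt]
  fun_prop

/-- The set of the values `α` at which the midpoint moves backwards. -/
def backwardsValues (K : Set Plane) : Set ℝ := {α | α ∈ Ioo (0 : ℝ) 1 ∧ (backwards K α).Nonempty}

lemma bddBelow_backwardsValues (K : Set Plane) : BddBelow (backwardsValues K) :=
  ⟨0, fun _ h => h.1.1.le⟩

lemma IsBody.backwardsValues_nonempty (hK : IsBody K) : (backwardsValues K).Nonempty := by
  have hα : (3 / 4 : ℝ) ∈ Ioo (0 : ℝ) 1 := by norm_num
  refine ⟨3 / 4, hα, ?_⟩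
  by_contra hB
  have h := hK.mid_mem_core_of_backwards_eq_empty hα (not_nonempty_iff_eq_empty.1 hB) 0
  rw [hK.mem_core_iff_depth hα] at h
  linarith [hK.depth_le_half (mid K (3 / 4) 0), hK.volume_pos]

/-- Below the critical value the midpoint never moves backwards; at the critical value, the
midpoints are limits of midpoints for smaller values of `α`. -/
lemma IsBody.mid_mem_core_iff (hK : IsBody K) {α : ℝ} (hα : α ∈ Ioo (0 : ℝ) 1) :
    (∀ φ, mid K α φ ∈ core K α) ↔ α ≤ alphaB K := by
  refine ⟨fun h => ?_, fun h φ => ?_⟩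
  · by_contra! hlt
    obtain ⟨β, ⟨hβ, hne⟩, hβα⟩ := exists_lt_of_csInf_lt hK.backwardsValues_nonempty hlt
    have := hne.mono (hK.backwards_subset hβ hα hβα.le)
    rw [hK.backwards_eq_empty_of_mid_mem_core hα h] at this
    exact not_nonempty_empty this
  · rw [hK.mem_core_iff hα]
    intro θ
    have hev : ∀ᶠ β in 𝓝[<] α, offset K β θ ≤ inner ℝ (mid K β φ) (nrm θ) := by
      filter_upwards [Ioo_mem_nhdsLT hα.1] with β hβ
      have hβ' : β ∈ Ioo (0 : ℝ) 1 := ⟨hβ.1, hβ.2.trans hα.2⟩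
      refine (hK.mem_core_iff hβ').1 (hK.mid_mem_core_of_backwards_eq_empty hβ' ?_ φ) θ
      by_contra hne
      have : alphaB K ≤ β := csInf_le (bddBelow_backwardsValues K)
        ⟨hβ', nonempty_iff_ne_empty.2 hne⟩
      linarith [hβ.2]
    exact le_of_tendsto_of_tendsto
      ((hK.continuousAt_offset_param hα θ).tendsto.mono_left nhdsWithin_le_nhds)
      (((hK.continuousAt_mid_param hα φ).inner continuousAt_const).tendsto.mono_left
        nhdsWithin_le_nhds) hev

lemma IsBody.alphaB_le (hK : IsBody K) {αK : ℝ} (h0 : 0 < αK) (h1 : αK < 1)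
    (h : ∀ α : ℝ, αK < α → α < 1 → core K α = ∅) : alphaB K ≤ αK := by
  by_contra! hlt
  obtain ⟨α, h2, h3⟩ := exists_between (lt_min hlt h1)
  have h4 : α < 1 := h3.trans_le (min_le_right _ _)
  have := (hK.mid_mem_core_iff ⟨h0.trans h2, h4⟩).2 (h3.le.trans (min_le_left _ _)) 0
  rw [h α h2 h4] at this
  exact this

/-! ### Symmetry -/

/-- If the midpoint never moves backwards for `α < 1/2`, all the midpoints of the sections that
halve the area belong to the core, which has at most one point for `α = 1/2`; so all these sections
are bisected by a common point, which is a center of symmetry. -/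
lemma IsBody.exists_backwards_of_not_isSymmetric (hK : IsBody K) (hs : ¬ IsSymmetric K) :
    ∃ α, α ∈ Ioo (0 : ℝ) 1 ∧ α < 1 / 2 ∧ (backwards K α).Nonempty := by
  by_contra! hcon
  apply hs
  have hα : (1 / 2 : ℝ) ∈ Ioo (0 : ℝ) 1 := by norm_num
  have hle : 1 / 2 ≤ alphaB K := by
    refine le_csInf hK.backwardsValues_nonempty fun α h => ?_
    by_contra! hlt
    exact h.2.ne_empty (hcon α h.1 hlt)
  have hmem := (hK.mid_mem_core_iff hα).2 hle
  have hsub : ∀ x ∈ core K (1 / 2), ∀ y ∈ core K (1 / 2), x = y := by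
    intro x hx y hy
    by_contra hne
    have hmid := hK.strictConvex_core hα hx hy hne (a := 1 / 2) (b := 1 / 2)
      (by norm_num) (by norm_num) (by norm_num)
    rw [hK.mem_interior_core_iff hα] at hmid
    linarith [hK.depth_le_half ((1 / 2 : ℝ) • x + (1 / 2 : ℝ) • y)]
  refine ⟨mid K (1 / 2) 0, fun x hx => ?_⟩
  obtain ⟨θ, hθ⟩ := exists_smul_dir (x - mid K (1 / 2) 0)
  set r := ‖x - mid K (1 / 2) 0‖
  have hp : mid K (1 / 2) 0 = pt θ (midAbs K (1 / 2) θ) (offset K (1 / 2) θ) := by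
    rw [← mid_eq_pt]
    exact hsub _ (hmem _) _ (hmem _)
  have hm := hK.meets_offset hα θ
  have hx' : x = pt θ (midAbs K (1 / 2) θ + r) (offset K (1 / 2) θ) := by
    rw [eq_add_of_sub_eq hθ, hp]
    simp only [pt]
    module
  have hy : AffineEquiv.pointReflection ℝ (mid K (1 / 2) 0) x =
      pt θ (midAbs K (1 / 2) θ - r) (offset K (1 / 2) θ) := by
    rw [AffineEquiv.pointReflection_apply, hp, hx']
    simp only [vsub_eq_sub, vadd_eq_add, pt]
    module
  rw [hy]
  rw [hx', hK.mem_iff hm] at hx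
  rw [hK.mem_iff hm]
  unfold midAbs at hx ⊢
  constructor <;> linarith [hx.1, hx.2]

/-- A slope between the one-sided derivatives is that of a supporting line. -/
lemma IsBody.reach_le (hK : IsBody K) {θ h t r : ℝ} (hm : Meets K θ h) (ht : t ∈ shadow K θ)
    (hr : rightSlope K θ h ≤ r) (hl : r ≤ leftSlope K θ h) :
    reach K θ t ≤ reach K θ h + r * (t - h) := by
  have hc := hK.concaveOn_reach θ
  have hh := interior_subset hm.mem_interior_shadow
  rcases lt_trichotomy t h with hlt | rfl | hlt
  · have h1 := hc.le_slope_of_hasDerivWithinAt_Iio ht hh hlt (hK.hasDerivWithinAt_leftSlope hm)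
    rw [slope_def_field, le_div_iff₀ (by linarith)] at h1
    nlinarith
  · simp
  · have h1 := hc.slope_le_of_hasDerivWithinAt_Ioi hh ht hlt (hK.hasDerivWithinAt_rightSlope hm)
    rw [slope_def_field, div_le_iff₀ (by linarith)] at h1
    nlinarith

lemma IsBody.rightSlope_le_leftSlope (hK : IsBody K) {θ h : ℝ} (hm : Meets K θ h) :
    rightSlope K θ h ≤ leftSlope K θ h := by
  have := (hK.concaveOn_reach θ).neg.leftDeriv_le_rightDeriv_of_mem_interior
    hm.mem_interior_shadow
  simpa [derivWithin.neg, leftSlope, rightSlope] using this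

/-- If two supporting lines of `K` at the ends of a chord meet on its left, they cut out together
with the chord a triangle that contains the part of `K` on the left of the chord. The slope `q` of
the line at the initial endpoint is written in the frame of direction `θ + π`, which does not change
slopes; the lines meet on the left because `p < q`. -/
lemma IsBody.exists_triangle (hK : IsBody K) {θ h p q : ℝ} (hm : Meets K θ h) (hpq : p < q)
    (hp : ∀ t ∈ shadow K θ, reach K θ t ≤ reach K θ h + p * (t - h))
    (hq : ∀ t ∈ shadow K (θ + π), reach K (θ + π) t ≤ reach K (θ + π) (-h) + q * (t - -h)) :
    ∃ a b c : Plane, AffineIndependent ℝ ![a, b, c] ∧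
      leftHalf θ h ∩ K ⊆ convexHull ℝ {a, b, c} ∧ segment ℝ b c ⊆ K ∧
      Disjoint (segment ℝ a b) (interior K) ∧ Disjoint (segment ℝ a c) (interior K) := by
  have hL := hK.neg_reach_lt_reach hm
  have hc := hK.reach_mem_of_meets hm
  have hb := hK.reach_mem_of_meets hm.add_pi
  rw [pt_add_pi, neg_neg] at hb
  have hR : ∀ s t, pt θ s t ∈ interior K → s < reach K θ h + p * (t - h) := fun s t hst =>
    (hK.lt_reach hst).trans_le (hp t ⟨s, interior_subset hst⟩)
  have hl : ∀ s t, pt θ s t ∈ interior K → -reach K (θ + π) (-h) + q * (t - h) < s := by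
    intro s t hst
    have hst' : pt (θ + π) (-s) (-t) ∈ interior K := by simpa [pt_add_pi] using hst
    linarith [(hK.lt_reach hst').trans_le (hq (-t) ⟨-s, interior_subset hst'⟩)]
  have hR' : ∀ s t, pt θ s t ∈ K → s ≤ reach K θ h + p * (t - h) := fun s t hst =>
    (hK.le_reach hst).trans (hp t ⟨s, hst⟩)
  have hl' : ∀ s t, pt θ s t ∈ K → -reach K (θ + π) (-h) + q * (t - h) ≤ s := by
    intro s t hst
    have hst' : pt (θ + π) (-s) (-t) ∈ K := by simpa [pt_add_pi] using hst
    linarith [(hK.le_reach hst').trans (hq (-t) ⟨-s, hst'⟩)]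
  set g := reach K θ h
  set f := -reach K (θ + π) (-h)
  -- the ordinate of the vertex above the chord
  obtain ⟨v, hv0, hv⟩ : ∃ v : ℝ, 0 < v ∧ (q - p) * v = g - f :=
    ⟨(g - f) / (q - p), div_pos (by linarith) (by linarith),
      mul_div_cancel₀ _ (by linarith)⟩
  have hfg : g + p * v = f + q * v := by linarith
  refine ⟨pt θ (g + p * v) (h + v), pt θ f h, pt θ g h, ?_, ?_, hK.convex.segment_subset hb hc,
    ?_, ?_⟩
  · rw [affineIndependent_iff_not_collinear_set, collinear_iff_of_mem
      (p₀ := pt θ f h) (by simp)]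
    rintro ⟨w, hw⟩
    obtain ⟨ra, ha⟩ := hw (pt θ (g + p * v) (h + v)) (by simp)
    obtain ⟨rc, hc⟩ := hw (pt θ g h) (by simp)
    rw [vadd_eq_add] at ha hc
    have e1 := congrArg (fun x : Plane => (inner ℝ x (nrm θ) : ℝ)) ha
    have e2 := congrArg (fun x : Plane => (inner ℝ x (nrm θ) : ℝ)) hc
    have e3 := congrArg (fun x : Plane => (inner ℝ x (dir θ) : ℝ)) hc
    simp only [inner_add_left, real_inner_smul_left, inner_pt_nrm_self, inner_pt_dir_self]
      at e1 e2 e3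
    have hrc : rc ≠ 0 := by
      rintro rfl
      linarith
    have hwn : (inner ℝ w (nrm θ) : ℝ) = 0 :=
      (mul_eq_zero.1 (by linarith)).resolve_left hrc
    rw [hwn] at e1
    linarith
  · rintro z ⟨hz1, hz2⟩
    rw [← pt_inner θ z] at hz2
    have h1 := hR' _ _ hz2
    have h2 := hl' _ _ hz2
    have hz1 : h ≤ inner ℝ z (nrm θ) := hz1
    rw [← pt_inner θ z]
    set s := (inner ℝ z (dir θ) : ℝ)
    set t := (inner ℝ z (nrm θ) : ℝ)
    have hgf : 0 < g - f := by linarith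
    -- the barycentric coordinates of the point with respect to the three vertices
    obtain ⟨wa, ha0, ha⟩ : ∃ w : ℝ, 0 ≤ w ∧ w * v = t - h :=
      ⟨(t - h) / v, div_nonneg (by linarith) hv0.le, div_mul_cancel₀ _ hv0.ne'⟩
    obtain ⟨wb, hb0, hwb⟩ : ∃ w : ℝ, 0 ≤ w ∧ w * (g - f) = g + p * (t - h) - s :=
      ⟨_, div_nonneg (by linarith) hgf.le, div_mul_cancel₀ _ hgf.ne'⟩
    obtain ⟨wc, hc0, hwc⟩ : ∃ w : ℝ, 0 ≤ w ∧ w * (g - f) = s - (f + q * (t - h)) :=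
      ⟨_, div_nonneg (by linarith) hgf.le, div_mul_cancel₀ _ hgf.ne'⟩
    have hsum : wa + wb + wc = 1 := by
      refine mul_right_cancel₀ hgf.ne' ?_
      linear_combination hwb + hwc + (q - p) * ha - wa * hv
    have key := (convex_convexHull ℝ
      {pt θ (g + p * v) (h + v), pt θ f h, pt θ g h}).sum_mem
      (t := (Finset.univ : Finset (Fin 3))) (w := ![wa, wb, wc])
      (z := ![pt θ (g + p * v) (h + v), pt θ f h, pt θ g h]) (fun i _ => by
        fin_cases i <;> assumption) (by
        simpa [Fin.sum_univ_three] using hsum) (fun i _ => by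
        apply subset_convexHull
        fin_cases i <;> simp)
    convert key using 1
    simp only [Fin.sum_univ_three, Matrix.cons_val, pt]
    match_scalars
    · linear_combination -hwc - q * ha - f * hsum - wa * hfg
    · linear_combination -ha - h * hsum
  · rw [Set.disjoint_left]
    rintro _ ⟨a, b, ha, hb, hab, rfl⟩ hin
    rw [pt_combo] at hin
    have := hl _ _ hin
    rw [hfg] at this
    obtain rfl : b = 1 - a := by linarith
    nlinarith
  · rw [Set.disjoint_left]
    rintro _ ⟨a, b, ha, hb, hab, rfl⟩ hin
    rw [pt_combo] at hin
    have := hR _ _ hin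
    obtain rfl : b = 1 - a := by linarith
    nlinarith

lemma IsBody.exists_triangle_of_not_isSymmetric (hK : IsBody K) (hs : ¬ IsSymmetric K) :
    ∃ a b c : Plane, AffineIndependent ℝ ![a, b, c] ∧
      volume.real K / 2 < volume.real (convexHull ℝ {a, b, c} ∩ K) ∧ segment ℝ b c ⊆ K ∧
      Disjoint (segment ℝ a b) (interior K) ∧ Disjoint (segment ℝ a c) (interior K) := by
  obtain ⟨α, hα, hα2, θ, hθ⟩ := hK.exists_backwards_of_not_isSymmetric hs
  have hm := hK.meets_offset hα θ
  have hp := hK.halfLength_pos hα θ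
  have main : ∃ a b c : Plane, AffineIndependent ℝ ![a, b, c] ∧
      leftHalf θ (offset K α θ) ∩ K ⊆ convexHull ℝ {a, b, c} ∧ segment ℝ b c ⊆ K ∧
      Disjoint (segment ℝ a b) (interior K) ∧ Disjoint (segment ℝ a c) (interior K) := by
    have hrl := hK.rightSlope_le_leftSlope hm
    have hrl' := hK.rightSlope_le_leftSlope hm.add_pi
    rw [mem_backwards, hK.velL_eq hα, hK.velR_eq hα] at hθ
    rcases hθ with hθ | hθ
    · exact hK.exists_triangle hm (sub_neg.1 ((pos_iff_neg_of_mul_neg hθ).1 (by linarith)))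
        (fun t ht => hK.reach_le hm ht hrl le_rfl)
        (fun t ht => hK.reach_le hm.add_pi ht hrl' le_rfl)
    · exact hK.exists_triangle hm (sub_neg.1 ((pos_iff_neg_of_mul_neg hθ).1 (by linarith)))
        (fun t ht => hK.reach_le hm ht le_rfl hrl)
        (fun t ht => hK.reach_le hm.add_pi ht le_rfl hrl')
  obtain ⟨a, b, c, h1, h2, h3⟩ := main
  refine ⟨a, b, c, h1, ?_, h3⟩
  have hV := hK.volume_pos
  calc volume.real K / 2 < (1 - α) * volume.real K := by nlinarith
    _ = volume.real (leftHalf θ (offset K α θ) ∩ K) := by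
      rw [leftHalf_eq_rightHalf]
      change _ = area K _ _
      rw [area_add_pi hK.isCompact, hK.area_offset hα]
      ring
    _ ≤ _ := measureReal_mono (subset_inter h2 inter_subset_right)
      (measure_ne_top_of_subset inter_subset_right hK.isCompact.measure_ne_top)

/-! ### Triangles with two sides outside the interior -/

lemma sum_coord (B : AffineBasis (Fin 3) ℝ Plane) (x : Plane) :
    B.coord 0 x + B.coord 1 x + B.coord 2 x = 1 := by
  rw [← Fin.sum_univ_three fun i => B.coord i x, B.sum_coord_apply_eq_one x]

lemma eq_sum_coord (B : AffineBasis (Fin 3) ℝ Plane) (x : Plane) :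
    x = B.coord 0 x • B 0 + B.coord 1 x • B 1 + B.coord 2 x • B 2 := by
  rw [← Fin.sum_univ_three fun i => B.coord i x • B i, B.linear_combination_coord_eq_self x]

/-- A convex set whose interior meets the interior of a triangle without meeting two of its sides
can leave the triangle only through the third side. -/
lemma coord_pos_of_mem_interior (hc : Convex ℝ K) (B : AffineBasis (Fin 3) ℝ Plane)
    (h1 : Disjoint (segment ℝ (B 0) (B 1)) (interior K))
    (h2 : Disjoint (segment ℝ (B 0) (B 2)) (interior K)) {x₀ x : Plane}
    (hx₀ : x₀ ∈ interior K) (h₀ : ∀ i, 0 < B.coord i x₀) (hx : x ∈ interior K)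
    (hx0 : 0 < B.coord 0 x) : 0 < B.coord 1 x ∧ 0 < B.coord 2 x := by
  by_contra hcon
  have hmin : min (B.coord 1 x) (B.coord 2 x) ≤ 0 := by
    rw [← not_lt, lt_min_iff]
    exact hcon
  have hconv : Convex ℝ (interior K ∩ B.coord 0 ⁻¹' Ioi 0) :=
    hc.interior.inter ((convex_Ioi 0).affine_preimage _)
  have hcont : Continuous fun z => min (B.coord 1 z) (B.coord 2 z) :=
    (continuous_barycentric_coord B 1).min (continuous_barycentric_coord B 2)
  obtain ⟨z, ⟨hzK, hz0⟩, hz⟩ := hconv.isPreconnected.intermediate_value ⟨hx, hx0⟩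
    ⟨hx₀, h₀ 0⟩ hcont.continuousOn ⟨hmin, (lt_min (h₀ 1) (h₀ 2)).le⟩
  have hz0 : 0 < B.coord 0 z := hz0
  have hz : min (B.coord 1 z) (B.coord 2 z) = 0 := hz
  have hs := sum_coord B z
  have he := eq_sum_coord B z
  rcases min_choice (B.coord 1 z) (B.coord 2 z) with h | h <;> rw [h] at hz
  · have hle : 0 ≤ B.coord 2 z := by rw [← hz, ← h]; exact min_le_right _ _
    refine Set.disjoint_left.1 h2 ⟨B.coord 0 z, B.coord 2 z, hz0.le, hle, by linarith, ?_⟩ hzK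
    rw [hz, zero_smul, add_zero] at he
    exact he.symm
  · have hle : 0 ≤ B.coord 1 z := by rw [← hz, ← h]; exact min_le_left _ _
    refine Set.disjoint_left.1 h1 ⟨B.coord 0 z, B.coord 1 z, hz0.le, hle, by linarith, ?_⟩ hzK
    rw [hz, zero_smul, add_zero] at he
    exact he.symm

lemma IsBody.coord_nonneg_of_mem (hK : IsBody K) (B : AffineBasis (Fin 3) ℝ Plane)
    (h1 : Disjoint (segment ℝ (B 0) (B 1)) (interior K))
    (h2 : Disjoint (segment ℝ (B 0) (B 2)) (interior K)) {x₀ x : Plane}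
    (hx₀ : x₀ ∈ interior K) (h₀ : ∀ i, 0 < B.coord i x₀) (hx : x ∈ K)
    (hx0 : 0 < B.coord 0 x) : 0 ≤ B.coord 1 x ∧ 0 ≤ B.coord 2 x := by
  have hcl : x ∈ closure (interior K) := by
    rw [hK.convex.closure_interior_eq_closure_of_nonempty_interior hK.nonempty]
    exact subset_closure hx
  have hopen : IsOpen {z | 0 < B.coord 0 z} :=
    isOpen_lt continuous_const (continuous_barycentric_coord B 0)
  have hcl' := hopen.inter_closure (t := interior K) ⟨hx0, hcl⟩
  have hclosed : IsClosed {z | 0 ≤ B.coord 1 z ∧ 0 ≤ B.coord 2 z} :=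
    (isClosed_le continuous_const (continuous_barycentric_coord B 1)).inter
      (isClosed_le continuous_const (continuous_barycentric_coord B 2))
  refine closure_minimal ?_ hclosed hcl'
  rintro z ⟨hz0, hz⟩
  exact (coord_pos_of_mem_interior hK.convex B h1 h2 hx₀ h₀ hz hz0).imp le_of_lt le_of_lt

lemma coord_pointReflection (B : AffineBasis (Fin 3) ℝ Plane) (i : Fin 3) (p x : Plane) :
    B.coord i (AffineEquiv.pointReflection ℝ p x) = 2 * B.coord i p - B.coord i x := by
  have h : AffineEquiv.pointReflection ℝ p x = AffineMap.lineMap x p (2 : ℝ) := by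
    rw [AffineEquiv.pointReflection_apply, AffineMap.lineMap_apply]
    simp only [vsub_eq_sub, vadd_eq_add]
    module
  rw [h, AffineMap.apply_lineMap, AffineMap.lineMap_apply]
  simp only [vsub_eq_sub, vadd_eq_add, smul_eq_mul]
  ring

/-- If `K` is symmetric about `p`, the area condition forces `p` to be on the same side of `bc` as
`a`. Then the reflection of `bc` is a segment of `K` inside the triangle, parallel to `bc` and as
long, which is absurd. -/
lemma IsBody.not_isSymmetric_of_triangle (hK : IsBody K) {a b c : Plane}
    (hi : AffineIndependent ℝ ![a, b, c])
    (hvol : volume.real K / 2 < volume.real (convexHull ℝ {a, b, c} ∩ K))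
    (hbc : segment ℝ b c ⊆ K) (h1 : Disjoint (segment ℝ a b) (interior K))
    (h2 : Disjoint (segment ℝ a c) (interior K)) : ¬ IsSymmetric K := by
  rintro ⟨p, hp⟩
  let B : AffineBasis (Fin 3) ℝ Plane :=
    ⟨![a, b, c], hi, hi.affineSpan_eq_top_iff_card_eq_finrank_add_one.2 (by simp)⟩
  have hrange : range B = {a, b, c} := by
    have : range B = range ![a, b, c] := rfl
    rw [this, Matrix.range_cons, Matrix.range_cons, Matrix.range_cons, Matrix.range_empty,
      union_empty]
    rfl
  rw [← hrange] at hvol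
  set T := convexHull ℝ (range B) with hT
  have hTeq : T = {x | ∀ i, 0 ≤ B.coord i x} := B.convexHull_eq_nonneg_coord
  have hTint : interior T = {x | ∀ i, 0 < B.coord i x} := B.interior_convexHull
  have hTc : IsCompact T := (finite_range B).isCompact_convexHull ℝ
  have hTconv : Convex ℝ T := convex_convexHull ℝ _
  have hV := hK.volume_pos
  have hfin : ∀ S, volume (S ∩ K) ≠ ⊤ := fun S =>
    measure_ne_top_of_subset inter_subset_right hK.isCompact.measure_ne_top
  have hfrT : volume (frontier T) = 0 := hTconv.addHaar_frontier volume
  have hfrK : volume (frontier K) = 0 := hK.convex.addHaar_frontier volume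
  -- the area of the triangle inside `K` is positive, so the interiors meet
  obtain ⟨x₀, hx₀T, hx₀K⟩ : (interior T ∩ interior K).Nonempty := by
    by_contra hne
    rw [not_nonempty_iff_eq_empty] at hne
    have hsub : T ∩ K ⊆ frontier T ∪ frontier K := by
      rintro x ⟨hxT, hxK⟩
      by_cases hx : x ∈ interior T
      · exact Or.inr ⟨subset_closure hxK, fun hx' => (hne ▸ ⟨hx, hx'⟩ : x ∈ (∅ : Set Plane))⟩
      · exact Or.inl ⟨subset_closure hxT, hx⟩
    have h0 : volume (T ∩ K) = 0 := measure_mono_null hsub (measure_union_null hfrT hfrK)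
    rw [Measure.real, Measure.real, h0, ENNReal.toReal_zero] at hvol
    have : 0 < (volume K).toReal := hV
    linarith
  have h₀ : ∀ i, 0 < B.coord i x₀ := by rw [hTint] at hx₀T; exact hx₀T
  -- the center of symmetry is on the side of the vertex `a`
  have hp0 : 0 < B.coord 0 p := by
    by_contra! hp0
    set ρ := AffineEquiv.pointReflection ℝ p
    have hρ : ∀ x, ρ x = (p + p) - x := fun x => by
      rw [AffineEquiv.pointReflection_apply]
      simp only [vsub_eq_sub, vadd_eq_add]
      abel
    have hmp : MeasurePreserving ρ := by
      rw [show (ρ : Plane → Plane) = fun x => (p + p) - x from funext hρ]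
      exact Measure.measurePreserving_sub_left volume (p + p)
    have himg : volume.real (ρ ⁻¹' (T ∩ K)) = volume.real (T ∩ K) := by
      have := hmp.measure_preimage (hTc.isClosed.measurableSet.inter
        hK.isCompact.measurableSet).nullMeasurableSet
      exact congrArg ENNReal.toReal this
    have hsubK : ρ ⁻¹' (T ∩ K) ⊆ K := by
      intro x hx
      have := hp _ hx.2
      rwa [show AffineEquiv.pointReflection ℝ p (ρ x) = x from
        AffineEquiv.pointReflection_involutive ℝ p x] at this
    have hd : AEDisjoint volume (T ∩ K) (ρ ⁻¹' (T ∩ K)) := by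
      refine measure_mono_null ?_ hfrT
      rintro x ⟨hx1, hx2⟩
      refine ⟨subset_closure hx1.1, fun hx => ?_⟩
      have e1 : 0 < B.coord 0 x := by rw [hTint] at hx; exact hx 0
      have e2 : 0 ≤ B.coord 0 (ρ x) := by
        have := hx2.1
        rw [hTeq] at this
        exact this 0
      rw [coord_pointReflection] at e2
      linarith
    have hm : MeasurableSet (ρ ⁻¹' (T ∩ K)) :=
      hmp.measurable (hTc.isClosed.measurableSet.inter hK.isCompact.measurableSet)
    have := measureReal_union₀ hm.nullMeasurableSet hd (hfin T)
      (measure_ne_top_of_subset hsubK hK.isCompact.measure_ne_top)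
    have hle : volume.real (T ∩ K ∪ ρ ⁻¹' (T ∩ K)) ≤ volume.real K :=
      measureReal_mono (union_subset inter_subset_right hsubK) hK.isCompact.measure_ne_top
    linarith
  -- the reflected segment
  have hB : ∀ i j, B.coord i (B j) = if i = j then 1 else 0 := fun i j => B.coord_apply i j
  have hb' := hp b (hbc (left_mem_segment ℝ b c))
  have hc' := hp c (hbc (right_mem_segment ℝ b c))
  have eb : ∀ i, B.coord i b = if i = 1 then 1 else 0 := fun i => hB i 1
  have ec : ∀ i, B.coord i c = if i = 2 then 1 else 0 := fun i => hB i 2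
  have nb := hK.coord_nonneg_of_mem B h1 h2 hx₀K h₀ hb' (by
    rw [coord_pointReflection, eb]; simpa using hp0)
  have nc := hK.coord_nonneg_of_mem B h1 h2 hx₀K h₀ hc' (by
    rw [coord_pointReflection, ec]; simpa using hp0)
  simp only [coord_pointReflection, eb, ec] at nb nc
  have hs := sum_coord B p
  have e1 := nb.1
  have e2 := nc.2
  norm_num at e1 e2
  linarith

end AlphaSection

end

theorem mainTheorem3 (K : Set AlphaSection.Plane) (hconv : Convex ℝ K) (hcomp : IsCompact K)
    (hint : (interior K).Nonempty) :
    -- the curve of midpoints is the envelope of the sections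
    (∀ α ∈ Set.Ioo (0 : ℝ) 1,
      AlphaSection.IsEnvelope (AlphaSection.offset K α) (AlphaSection.mid K α)) ∧
    -- its image is the boundary of the core exactly up to the critical value
    (∀ α ∈ Set.Ioo (0 : ℝ) 1,
      AlphaSection.midImage K α = frontier (AlphaSection.core K α) ↔ α ≤ AlphaSection.alphaB K) ∧
    -- the critical value of the core
    (∃ αK : ℝ, AlphaSection.alphaB K ≤ αK ∧ 0 < αK ∧ αK ≤ 1 / 2 ∧
      (∀ α : ℝ, 0 < α → α < αK →
        StrictConvex ℝ (AlphaSection.core K α) ∧ (interior (AlphaSection.core K α)).Nonempty) ∧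
      (∃ p : AlphaSection.Plane, AlphaSection.core K αK = {p}) ∧
      (∀ α : ℝ, αK < α → α < 1 → AlphaSection.core K α = ∅)) ∧
    -- the characterization of non-symmetric bodies by a triangle
    (¬ AlphaSection.IsSymmetric K ↔
      ∃ a b c : AlphaSection.Plane, AffineIndependent ℝ ![a, b, c] ∧
        MeasureTheory.volume.real K / 2 <
          MeasureTheory.volume.real (convexHull ℝ {a, b, c} ∩ K) ∧
        segment ℝ b c ⊆ K ∧
        Disjoint (segment ℝ a b) (interior K) ∧ Disjoint (segment ℝ a c) (interior K)) := by
  have hK : AlphaSection.IsBody K := ⟨hconv, hcomp, hint⟩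
  obtain ⟨αK, h0, h1, h2, h3, h4⟩ := hK.exists_critical
  refine ⟨fun α hα => hK.isEnvelope hα,
    fun α hα => (hK.midImage_eq_frontier_iff hα).trans (hK.mid_mem_core_iff hα),
    ⟨αK, hK.alphaB_le h0 (by linarith) h4, h0, h1, h2, h3, h4⟩,
    hK.exists_triangle_of_not_isSymmetric, ?_⟩
  rintro ⟨a, b, c, hi, hvol, hbc, hab, hac⟩
  exact hK.not_isSymmetric_of_triangle hi hvol hbc hab hac
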